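/- Let $\kappa$ be a regular (infinite) cardinal and let $I$ be a small category. All other categories are locally small. For a category $\mathcal{C}$, let $\mathrm{Ind}_\kappa(\mathcal{C})$ be the full subcategory of the category of presheaves of sets on $\mathcal{C}$ whose objects are the small $\kappa$-filtered colimits of representable presheaves; a functor $G:\mathcal{C}\to\mathcal{D}$ induces an essentially unique functor $\mathrm{Ind}_\kappa(G):\mathrm{Ind}_\kappa(\mathcal{C})\to\mathrm{Ind}_\kappa(\mathcal{D})$ that extends $G$ and preserves $\kappa$-filtered colimits. Let $$E^I_{\mathcal{C},\kappa}:\mathrm{Ind}_\kappa(\mathcal{C}^I)\to \mathrm{Ind}_\kappa(\mathcal{C})^I$$ be the functor whose component at $i\in I$ is $\mathrm{Ind}_\kappa(\mathrm{ev}_i)$, where $\mathrm{ev}_i:\mathcal{C}^I\to\mathcal{C}$ is evaluation at $i$. For a $\kappa$-accessible category $A$, let $A_\kappa$ denote its full subcategory of $\kappa$-presentable objects. Theorem. The following conditions are equivalent. (A1) For every category $\mathcal{C}$, the functor $E^I_{\mathcal{C},\kappa}$ is an equivalence. (A2) For every Cauchy complete category $\mathcal{C}$ (that is, one in which every idempotent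 splits), the functor $E^I_{\mathcal{C},\kappa}$ is an equivalence. (A3) For every $\kappa$-accessible category $A$, the functor category $A^I$ is $\kappa$-accessible, and an object $F:I\to A$ of $A^I$ is $\kappa$-presentable if and only if $F(i)\in A_\kappa$ for all $i\in I$. (A4) $I$ is essentially $\kappa$-small (equivalent to a category with fewer than $\kappa$ arrows) and well-founded: it has no non-identity endomorphisms, and its posetal reflection (the set of objects preordered by $x\leqslant y$ if and only if there is an arrow $x\to y$, modulo the equivalence relation "$x\leqslant y$ and $y\leqslant x$") is a well-founded poset, i.e. has no infinite strictly descending chain. -/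

import Mathlib

open CategoryTheory Limits

universe w u u₁ u₂

namespace IndFunctorCat

section Ind

variable {C : Type u} [Category.{w} C] (κ : Cardinal.{w}) [Fact κ.IsRegular]

/-- A presheaf of sets is a `κ`-ind-object if it is the colimit of a diagram of representables
indexed by a small `κ`-filtered category. -/
def isIndObject (C : Type u) [Category.{w} C] (κ : Cardinal.{w}) [Fact κ.IsRegular] :
    ObjectProperty (Cᵒᵖ ⥤ Type w) :=
  fun P => ∃ p : IndObjectPresentation P, IsCardinalFiltered p.I κ

/-- The `κ`-ind completion `Ind_κ(C)` of a (locally small) category `C`: the full subcategory of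
the category of presheaves whose objects are the small `κ`-filtered colimits of representables. -/
abbrev IndCat (C : Type u) [Category.{w} C] (κ : Cardinal.{w}) [Fact κ.IsRegular] :=
  (isIndObject C κ).FullSubcategory

theorem isIndObject_yoneda (X : C) : isIndObject C κ (yoneda.obj X) := by
  refine ⟨IndObjectPresentation.yoneda X, ?_⟩
  have : HasTerminal (Discrete PUnit.{w + 1}) := hasTerminal_of_unique (⟨PUnit.unit⟩)
  exact isCardinalFiltered_of_hasTerminal (Discrete PUnit.{w + 1}) κ

/-- The canonical embedding `C ⥤ Ind_κ(C)`. -/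
abbrev toInd (C : Type u) [Category.{w} C] (κ : Cardinal.{w}) [Fact κ.IsRegular] :
    C ⥤ IndCat C κ :=
  (isIndObject C κ).lift yoneda (isIndObject_yoneda κ)

/-- The diagram of arrows from objects of `C` to a `κ`-ind-object given by a presentation. -/
def presentationFunctor {P : IndCat C κ} (p : IndObjectPresentation P.obj) :
    p.I ⥤ CostructuredArrow (toInd C κ) P where
  obj j := CostructuredArrow.mk (Y := p.F.obj j) (ObjectProperty.homMk (p.ι.app j))
  map f := CostructuredArrow.homMk (p.F.map f) (by
    apply ObjectProperty.hom_ext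
    exact (p.ι.naturality f).trans (Category.comp_id _))

theorem presentationFunctor_final {P : IndCat C κ} (p : IndObjectPresentation P.obj) :
    (presentationFunctor κ p).Final := by
  rw [Functor.final_iff_comp_equivalence _
    (CostructuredArrow.post (toInd C κ) (isIndObject C κ).ι P)]
  exact inferInstanceAs p.toCostructuredArrow.Final

/-- The image in `Ind_κ(C)` of a small `κ`-filtered diagram in `C` has a colimit. -/
theorem hasColimit_toInd {J : Type w} [SmallCategory J] [IsCardinalFiltered J κ] (F : J ⥤ C) :
    HasColimit (F ⋙ toInd C κ) := by
  have := isFiltered_of_isCardinalFiltered J κ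
  let c : Cocone (F ⋙ toInd C κ) :=
    { pt := ⟨colimit (F ⋙ yoneda),
        ⟨{ I := J, F := F, ι := (colimit.cocone (F ⋙ yoneda)).ι,
           isColimit := colimit.isColimit (F ⋙ yoneda) }, ‹_›⟩⟩
      ι :=
        { app := fun j => ObjectProperty.homMk (colimit.ι (F ⋙ yoneda) j)
          naturality := fun i j f => by
            apply ObjectProperty.hom_ext
            exact (colimit.cocone (F ⋙ yoneda)).ι.naturality f } }
  have hc : IsColimit ((isIndObject C κ).ι.mapCocone c) := colimit.isColimit (F ⋙ yoneda)
  exact ⟨⟨⟨c, isColimitOfReflects (isIndObject C κ).ι hc⟩⟩⟩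

end Ind

section Functoriality

variable (C : Type u₁) [Category.{w} C] (D : Type u₂) [Category.{w} D]
  (κ : Cardinal.{w}) [Fact κ.IsRegular]

instance hasPointwiseLeftKanExtension_toInd (G : C ⥤ D) :
    (toInd C κ).HasPointwiseLeftKanExtension (G ⋙ toInd D κ) := by
  intro P
  obtain ⟨p, hp⟩ := P.property
  have := presentationFunctor_final κ p
  have : HasColimit (presentationFunctor κ p ⋙
      CostructuredArrow.proj (toInd C κ) P ⋙ G ⋙ toInd D κ) :=
    hasColimit_toInd κ (p.F ⋙ G)
  exact Functor.Final.hasColimit_of_comp (presentationFunctor κ p)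

variable {C D}

/-- The functor `Ind_κ(G) : Ind_κ(C) ⥤ Ind_κ(D)` induced by `G : C ⥤ D`, i.e. the extension
of `C ⥤ D ⥤ Ind_κ(D)` which preserves `κ`-filtered colimits: it sends an object `P` to the
colimit of the `G X` (computed in `Ind_κ(D)`) over all arrows `X ⟶ P` with `X` in `C`. -/
noncomputable def indMap (G : C ⥤ D) : IndCat C κ ⥤ IndCat D κ :=
  (toInd C κ).pointwiseLeftKanExtension (G ⋙ toInd D κ)

/-- The canonical comparison between `Ind_κ(G)` and `G` on objects of `C`. -/
noncomputable def indMapUnit (G : C ⥤ D) : G ⋙ toInd D κ ⟶ toInd C κ ⋙ indMap κ G :=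
  (toInd C κ).pointwiseLeftKanExtensionUnit (G ⋙ toInd D κ)

instance indMap_isLeftKanExtension (G : C ⥤ D) :
    (indMap κ G).IsLeftKanExtension (indMapUnit κ G) :=
  inferInstanceAs (((toInd C κ).pointwiseLeftKanExtension (G ⋙ toInd D κ)).IsLeftKanExtension
    ((toInd C κ).pointwiseLeftKanExtensionUnit (G ⋙ toInd D κ)))

variable (C D)

/-- The functor `Ind_κ` on functors and natural transformations. -/
noncomputable def indFunctor : (C ⥤ D) ⥤ (IndCat C κ ⥤ IndCat D κ) where
  obj G := indMap κ G
  map {G G'} α := (indMap κ G).descOfIsLeftKanExtension (indMapUnit κ G) (indMap κ G')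
    (Functor.whiskerRight α (toInd D κ) ≫ indMapUnit κ G')
  map_id G := by
    apply (indMap κ G).hom_ext_of_isLeftKanExtension (indMapUnit κ G)
    simp
  map_comp {G G' G''} α β := by
    apply (indMap κ G).hom_ext_of_isLeftKanExtension (indMapUnit κ G)
    simp

end Functoriality

/-- The comparison functor `E : Ind_κ(C^I) ⥤ Ind_κ(C)^I`, whose component at an object `i` of `I`
is the functor `Ind_κ(C^I) ⥤ Ind_κ(C)` induced by the evaluation functor at `i`. -/
noncomputable def comparison (I : Type w) [SmallCategory I] (C : Type u) [Category.{w} C]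
    (κ : Cardinal.{w}) [Fact κ.IsRegular] :
    IndCat (I ⥤ C) κ ⥤ (I ⥤ IndCat C κ) :=
  (evaluation I C ⋙ indFunctor (I ⥤ C) C κ).flip

/-- A category is essentially `κ`-small if it is equivalent to a category with fewer than `κ`
arrows. -/
def IsEssentiallyCardinalSmall (I : Type u) [Category.{u₁} I] (κ : Cardinal.{w}) : Prop :=
  ∃ (J : Type w) (_ : SmallCategory J), HasCardinalLT (Arrow J) κ ∧ Nonempty (I ≌ J)

/-- The objects of `I`, preordered by `x ≤ y` if there is an arrow `x ⟶ y`. -/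
def HomOrder (I : Type u) [Category.{u₁} I] : Type u := I

instance (I : Type u) [Category.{u₁} I] : Preorder (HomOrder I) where
  le x y := Nonempty (Quiver.Hom (V := I) x y)
  le_refl x := ⟨CategoryStruct.id (obj := I) x⟩
  le_trans _ _ _ := fun ⟨f⟩ ⟨g⟩ => ⟨CategoryStruct.comp (obj := I) f g⟩

/-- The posetal reflection of `I`: the quotient of the preordered set of objects of `I` by the
equivalence relation `x ≤ y ∧ y ≤ x`, with its induced partial order. -/
abbrev PosetalReflection (I : Type u) [Category.{u₁} I] : Type u :=
  Antisymmetrization (HomOrder I) (· ≤ ·)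

/-- A category is well-founded if it has no non-identity endomorphisms and its posetal reflection
is a well-founded poset. -/
structure IsWellFoundedCategory (I : Type u) [Category.{u₁} I] : Prop where
  endo_eq_id : ∀ (x : I) (f : x ⟶ x), f = 𝟙 x
  wellFounded : WellFounded fun x y : PosetalReflection I => x < y

end IndFunctorCat

/-! Everything rests on a recognition principle: a category with enough `κ`-filtered colimits is
determined, as an ind-completion, by a fully faithful family of `κ`-presentable objects of which
every object is a `κ`-filtered colimit (`IsIndEmbedding`, `IsIndEmbedding.isEquivalence`). Hence the
comparison functor is an equivalence exactly when the pointwise embedding of `C^I` into `Ind_κ(C)^I`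
has this property (`isEquivalence_comparison_iff`).

(A4) implies (A1). When `I` has fewer than `κ` arrows, pointwise presentable functors are
presentable, so the point is to write each `F : I ⥤ Ind_κ(C)` as a `κ`-filtered colimit of functors
with values in `C`. On a skeleton the non-identity arrows form a well-founded relation, and functors
to `C` lying over `F` can be built by recursion: stage `i` has to receive fewer than `κ` earlier
objects and satisfy fewer than `κ` equations, which the `κ`-filtered category of arrows from `C` to
`F(i)` allows (`exists_cocone_functorCostructuredArrow`). The same recursion shows that the functors
over `F` form a `κ`-filtered category and that evaluation at each `i` is final, so that `F` is their
colimit.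

(A2) implies (A3). A `κ`-accessible `A` is `Ind_κ(A_κ)` with `A_κ` Cauchy complete, and the
presentable objects of `A^I` are retracts of functors with values in `A_κ`.

(A3) implies (A4). Two accessible categories serve as tests. The first is `Ind_κ` of `Graded I
κ.ord.ToType`, in which objects of `I` acquire an ordinal degree that every non-identity arrow
raises. Each object of `I` becomes a colimit of its graded copies, and presentable approximations of
this diagram force endomorphisms of `I` to be trivial and descending chains to stop. The second is
the category of sets, which bounds the number of isomorphism classes and the sizes of the hom-sets.
-/

namespace IndFunctorCat

universe v₁ v₂ v₃ v₄ u₃ u₄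

open Opposite

/-! ### Recognition of ind-completions. -/

section IndEmbedding

variable {D : Type u₁} [Category.{v₁} D] {B : Type u₂} [Category.{v₂} B]
  {κ : Cardinal.{w}} [Fact κ.IsRegular]

/-- A functor `Φ : D ⥤ B` exhibits `B` as a category of `κ`-ind-objects of `D` if it is fully
faithful, takes values in `κ`-presentable objects, and if any object of `B` is a small
`κ`-filtered colimit of objects in the image of `Φ`. -/
structure IsIndEmbedding (Φ : D ⥤ B) (κ : Cardinal.{w}) [Fact κ.IsRegular] : Prop where
  full : Φ.Full
  faithful : Φ.Faithful
  isCardinalPresentable (X : D) : IsCardinalPresentable (Φ.obj X) κ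
  exists_isColimit (Y : B) :
    ∃ (J : Type w) (_ : SmallCategory J) (_ : IsCardinalFiltered J κ) (F : J ⥤ D)
      (α : F ⋙ Φ ⟶ (Functor.const J).obj Y), Nonempty (IsColimit (Cocone.mk Y α))

/-- The functor from the index category of a cocone over `F ⋙ Φ` to the category of
costructured arrows over its point. -/
def coconeToCostructuredArrow {J : Type u₃} [Category.{v₃} J] {F : J ⥤ D} {Φ : D ⥤ B}
    (c : Cocone (F ⋙ Φ)) : J ⥤ CostructuredArrow Φ c.pt where
  obj j := CostructuredArrow.mk (Y := F.obj j) (c.ι.app j)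
  map f := CostructuredArrow.homMk (F.map f) (c.w f)

/-- For a filtered index category finality has two parts: arrows from a presentable object to the
colimit factor through a stage, and two factorizations agree at a later stage. Full faithfulness
turns these arrows of `B` into arrows of `D`. -/
lemma final_coconeToCostructuredArrow {Φ : D ⥤ B} [Φ.Full] [Φ.Faithful]
    (hΦ : ∀ X, IsCardinalPresentable (Φ.obj X) κ)
    {J : Type w} [SmallCategory J] [IsCardinalFiltered J κ] {F : J ⥤ D}
    {c : Cocone (F ⋙ Φ)} (hc : IsColimit c) : (coconeToCostructuredArrow c).Final := by
  have := isFiltered_of_isCardinalFiltered J κ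
  have := essentiallySmallSelf J
  rw [Functor.final_iff_of_isFiltered]
  refine ⟨fun f ↦ ?_, fun {f j} g₁ g₂ ↦ ?_⟩
  · have := hΦ f.left
    obtain ⟨j, g, hg⟩ := IsCardinalPresentable.exists_hom_of_isColimit κ hc f.hom
    obtain ⟨g, rfl⟩ := Φ.map_surjective (Y := F.obj j) g
    exact ⟨j, ⟨CostructuredArrow.homMk g hg⟩⟩
  · have := hΦ f.left
    obtain ⟨k, a, h⟩ := IsCardinalPresentable.exists_eq_of_isColimit' κ hc
      (Φ.map g₁.left) (Φ.map g₂.left)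
      ((CostructuredArrow.w g₁).trans (CostructuredArrow.w g₂).symm)
    refine ⟨k, a, CostructuredArrow.hom_ext _ _ (Φ.map_injective ?_)⟩
    exact (Φ.map_comp _ _).trans (h.trans (Φ.map_comp _ _).symm)

namespace IsIndEmbedding

lemma of_iso {Φ Ψ : D ⥤ B} (h : IsIndEmbedding Φ κ) (e : Φ ≅ Ψ) : IsIndEmbedding Ψ κ where
  full := have := h.full; Functor.Full.of_iso e
  faithful := have := h.faithful; Functor.Faithful.of_iso e
  isCardinalPresentable X :=
    have := h.isCardinalPresentable X
    isCardinalPresentable_of_iso (e.app X) κ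
  exists_isColimit Y := by
    obtain ⟨J, _, _, F, α, ⟨hα⟩⟩ := h.exists_isColimit Y
    exact ⟨J, inferInstance, inferInstance, F, Functor.whiskerLeft F e.inv ≫ α,
      ⟨(IsColimit.precomposeHomEquiv (Functor.isoWhiskerLeft F e).symm _).symm hα⟩⟩

lemma comp_isEquivalence {Φ : D ⥤ B} (h : IsIndEmbedding Φ κ) {B' : Type u₃} [Category.{v₃} B']
    (E : B ⥤ B') [E.IsEquivalence] : IsIndEmbedding (Φ ⋙ E) κ where
  full := have := h.full; inferInstance
  faithful := have := h.faithful; inferInstance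
  isCardinalPresentable X :=
    have := h.isCardinalPresentable X
    isCardinalPresentable_of_isEquivalence _ κ E
  exists_isColimit Y := by
    obtain ⟨J, _, _, F, α, ⟨hα⟩⟩ := h.exists_isColimit (E.objPreimage Y)
    let e := E.objObjPreimageIso Y
    refine ⟨J, inferInstance, inferInstance, F,
      { app j := E.map (α.app j) ≫ e.hom
        naturality i j f := ?_ }, ⟨?_⟩⟩
    · have := α.naturality f
      dsimp at this ⊢
      rw [← Functor.map_comp_assoc, this]
      simp
    · exact IsColimit.ofIsoColimit (isColimitOfPreserves E hα) (Cocone.ext e)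

lemma isEquivalence_comp {Φ : D ⥤ B} (h : IsIndEmbedding Φ κ) {D' : Type u₃} [Category.{v₃} D']
    (E : D' ⥤ D) [E.IsEquivalence] : IsIndEmbedding (E ⋙ Φ) κ where
  full := have := h.full; inferInstance
  faithful := have := h.faithful; inferInstance
  isCardinalPresentable X := h.isCardinalPresentable (E.obj X)
  exists_isColimit Y := by
    obtain ⟨J, _, _, F, α, ⟨hα⟩⟩ := h.exists_isColimit Y
    let e : (F ⋙ E.inv) ⋙ E ⋙ Φ ≅ F ⋙ Φ :=
      Functor.isoWhiskerLeft F (Functor.isoWhiskerRight E.asEquivalence.counitIso Φ)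
    exact ⟨J, inferInstance, inferInstance, F ⋙ E.inv, e.hom ≫ α,
      ⟨(IsColimit.precomposeHomEquiv e _).symm hα⟩⟩

lemma retract_of_isCardinalPresentable {Φ : D ⥤ B} (h : IsIndEmbedding Φ κ) (Y : B)
    [IsCardinalPresentable Y κ] : ∃ X : D, Nonempty (Retract Y (Φ.obj X)) := by
  obtain ⟨J, _, _, F, α, ⟨hα⟩⟩ := h.exists_isColimit Y
  have := essentiallySmallSelf J
  obtain ⟨j, f, hf⟩ := IsCardinalPresentable.exists_hom_of_isColimit κ hα (𝟙 Y)
  exact ⟨F.obj j, ⟨{ i := f, r := α.app j, retract := hf }⟩⟩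

/-- An arrow is determined by its restrictions along a small colimit cocone, and each restriction
factors through one of a small set of arrows of `D`. -/
lemma locallySmall {Φ : D ⥤ B} (h : IsIndEmbedding Φ κ) [LocallySmall.{w} D] :
    LocallySmall.{w} B := by
  have := h.full
  have := h.faithful
  exact ⟨fun X Y ↦ by
    obtain ⟨J, _, _, F, α, ⟨hα⟩⟩ := h.exists_isColimit X
    obtain ⟨J', _, _, F', α', ⟨hα'⟩⟩ := h.exists_isColimit Y
    have (j : J) : Small.{w} (Φ.obj (F.obj j) ⟶ Y) := by
      have := h.isCardinalPresentable (F.obj j)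
      have := essentiallySmallSelf J'
      have (j' : J') : Small.{w} (Φ.obj (F.obj j) ⟶ Φ.obj (F'.obj j')) :=
        small_of_injective (f := Φ.preimage) fun _ _ h ↦ by
          simpa using congr_arg Φ.map h
      refine small_of_surjective
        (f := fun (x : Σ j' : J', (Φ.obj (F.obj j) ⟶ Φ.obj (F'.obj j'))) ↦ x.2 ≫ α'.app x.1)
        fun g ↦ ?_
      obtain ⟨j', f, hf⟩ := IsCardinalPresentable.exists_hom_of_isColimit κ hα' g
      exact ⟨⟨j', f⟩, hf⟩
    exact small_of_injective
      (f := fun (g : X ⟶ Y) (j : J) ↦ (α.app j ≫ g : Φ.obj (F.obj j) ⟶ Y))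
      fun f g hfg ↦ hα.hom_ext fun j ↦ congr_fun hfg j⟩

lemma isCardinalAccessibleCategory {Φ : D ⥤ B} (h : IsIndEmbedding Φ κ)
    [EssentiallySmall.{w} D] [HasCardinalFilteredColimits B κ] :
    IsCardinalAccessibleCategory B κ := by
  have := locallySmall_of_essentiallySmall D
  have := h.locallySmall
  let P : ObjectProperty B := ObjectProperty.ofObj fun X : SmallModel.{w} D ↦
    Φ.obj ((equivSmallModel.{w} D).inverse.obj X)
  have hP : P.IsCardinalFilteredGenerator κ :=
    { le_isCardinalPresentable := by
        rintro _ ⟨X⟩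
        exact h.isCardinalPresentable _
      exists_colimitsOfShape Y := by
        obtain ⟨J, _, _, F, α, ⟨hα⟩⟩ :=
          (h.isEquivalence_comp (equivSmallModel.{w} D).inverse).exists_isColimit Y
        exact ⟨J, inferInstance, inferInstance, ⟨
          { diag := _
            ι := α
            isColimit := hα
            prop_diag_obj j := ⟨F.obj j⟩ }⟩⟩ }
  have := hP.hasCardinalFilteredGenerator
  constructor

/-- Arrows between colimits are controlled by arrows between presentable stages, on which `Ψ` and `Ψ
⋙ E` are both fully faithful. Existence and preservation of colimits are required only for diagrams
coming from `D`, so that they can be checked on Kan extensions. -/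
theorem isEquivalence {A : Type u₃} [Category.{v₃} A] {Ψ : D ⥤ A} (hΨ : IsIndEmbedding Ψ κ)
    (E : A ⥤ B) (hE : IsIndEmbedding (Ψ ⋙ E) κ)
    (h₁ : ∀ (J : Type w) [SmallCategory J] [IsCardinalFiltered J κ] (F : J ⥤ D),
      HasColimit (F ⋙ Ψ))
    (h₂ : ∀ (J : Type w) [SmallCategory J] [IsCardinalFiltered J κ] (F : J ⥤ D),
      PreservesColimit (F ⋙ Ψ) E) :
    E.IsEquivalence := by
  have := hΨ.full
  have := hΨ.faithful
  have := hE.full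
  have := hE.faithful
  have faithful : E.Faithful := ⟨fun {P Q f g} hfg ↦ by
    obtain ⟨J, _, _, F, α, ⟨hα⟩⟩ := hΨ.exists_isColimit P
    obtain ⟨J', _, _, F', α', ⟨hα'⟩⟩ := hΨ.exists_isColimit Q
    have := essentiallySmallSelf J'
    refine hα.hom_ext fun j ↦ ?_
    have := hΨ.isCardinalPresentable (F.obj j)
    have : IsCardinalPresentable (E.obj (Ψ.obj (F.obj j))) κ :=
      hE.isCardinalPresentable (F.obj j)
    obtain ⟨k, f', hf'⟩ := IsCardinalPresentable.exists_hom_of_isColimit κ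
      (X := Ψ.obj (F.obj j)) hα' (α.app j ≫ f)
    obtain ⟨k', g', hg'⟩ := IsCardinalPresentable.exists_hom_of_isColimit κ
      (X := Ψ.obj (F.obj j)) hα' (α.app j ≫ g)
    dsimp at f' hf' g' hg'
    -- The two factorizations become equal in `B` after applying `E`; presentability there makes
    -- them equal at a stage `l`, and faithfulness of `Ψ ⋙ E` brings the equality back.
    obtain ⟨l, a, b, h⟩ := IsCardinalPresentable.exists_eq_of_isColimit κ
      (X := E.obj (Ψ.obj (F.obj j)))
      (isColimitOfPreserves E hα') (E.map f') (E.map g')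
      (by dsimp; rw [← E.map_comp, ← E.map_comp, hf', hg', E.map_comp, E.map_comp, hfg])
    have h' : f' ≫ Ψ.map (F'.map a) = g' ≫ Ψ.map (F'.map b) := by
      obtain ⟨f', rfl⟩ := Ψ.map_surjective f'
      obtain ⟨g', rfl⟩ := Ψ.map_surjective g'
      rw [← Ψ.map_comp, ← Ψ.map_comp]
      congr 1
      exact (Ψ ⋙ E).map_injective (by simpa using h)
    have wa : Ψ.map (F'.map a) ≫ α'.app l = α'.app k := (Cocone.mk Q α').w a
    have wb : Ψ.map (F'.map b) ≫ α'.app l = α'.app k' := (Cocone.mk Q α').w b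
    dsimp
    rw [← hf', ← hg', ← wa, ← wb, reassoc_of% h']⟩
  have full : E.Full := ⟨fun {P Q} f ↦ by
    obtain ⟨J, _, _, F, α, ⟨hα⟩⟩ := hΨ.exists_isColimit P
    obtain ⟨J', _, _, F', α', ⟨hα'⟩⟩ := hΨ.exists_isColimit Q
    have := essentiallySmallSelf J'
    have (j : J) : ∃ (g : Ψ.obj (F.obj j) ⟶ Q), E.map g = E.map (α.app j) ≫ f := by
      have : IsCardinalPresentable (E.obj (Ψ.obj (F.obj j))) κ := hE.isCardinalPresentable (F.obj j)
      obtain ⟨k, f', hf'⟩ := IsCardinalPresentable.exists_hom_of_isColimit κ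
        (X := E.obj (Ψ.obj (F.obj j)))
        (isColimitOfPreserves E hα') (E.map (α.app j) ≫ f)
      obtain ⟨f', rfl⟩ := (Ψ ⋙ E).map_surjective f'
      exact ⟨Ψ.map f' ≫ α'.app k, by simpa using hf'⟩
    choose g hg using this
    let c : Cocone (F ⋙ Ψ) :=
      { pt := Q
        ι :=
          { app := g
            naturality i j φ := E.map_injective (by
              have := α.naturality φ
              dsimp at this ⊢
              rw [E.map_comp, hg, ← E.map_comp_assoc, this]
              simp [hg]) } }
    refine ⟨hα.desc c, (isColimitOfPreserves E hα).hom_ext fun j ↦ ?_⟩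
    have := hα.fac c j
    dsimp at this ⊢
    rw [← E.map_comp, this, hg]⟩
  have essSurj : E.EssSurj := ⟨fun Y ↦ by
    obtain ⟨J, _, _, F, α, ⟨hα⟩⟩ := hE.exists_isColimit Y
    exact ⟨colimit (F ⋙ Ψ),
      ⟨(isColimitOfPreserves E (colimit.isColimit (F ⋙ Ψ))).coconePointUniqueUpToIso hα⟩⟩⟩
  exact { }

end IsIndEmbedding

end IndEmbedding

/-! ### Comma categories over a filtered colimit. -/

section CostructuredArrow

variable {D : Type u₁} [Category.{v₁} D] {B : Type u₂} [Category.{v₂} B]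
  {κ : Cardinal.{w}} [Fact κ.IsRegular]

lemma isCardinalFiltered_of_fullyFaithful {K : Type u₁} [Category.{v₁} K] {S : Type u₂}
    [Category.{v₂} S] (F : S ⥤ K) [F.Full] [F.Faithful] [IsCardinalFiltered K κ]
    (hF : ∀ k : K, ∃ s : S, Nonempty (k ⟶ F.obj s)) : IsCardinalFiltered S κ where
  nonempty_cocone {A _} G hA := by
    let c := IsCardinalFiltered.cocone (G ⋙ F) hA
    obtain ⟨s, ⟨f⟩⟩ := hF c.pt
    exact ⟨
      { pt := s
        ι :=
          { app a := F.preimage (c.ι.app a ≫ f)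
            naturality a b g := F.map_injective (by
              have := c.w g
              dsimp at this ⊢
              simp [reassoc_of% this]) } }⟩

/-- Fewer than `κ` objects and parallel arrows over the colimit already live over a single stage of
the diagram, where the required bound or coequalizing arrow exists; it is then pushed forward to the
colimit. -/
lemma isCardinalFiltered_costructuredArrow_of_isColimit {Φ : D ⥤ B}
    (hΦ : ∀ X, IsCardinalPresentable (Φ.obj X) κ)
    {J : Type w} [SmallCategory J] [IsCardinalFiltered J κ] {P : J ⥤ B}
    {c : Cocone P} (hc : IsColimit c)
    (hP : ∀ j, IsCardinalFiltered (CostructuredArrow Φ (P.obj j)) κ) :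
    IsCardinalFiltered (CostructuredArrow Φ c.pt) κ := by
  have := essentiallySmallSelf J
  have := isFiltered_of_isCardinalFiltered J κ
  have lift (X : CostructuredArrow Φ c.pt) :
      ∃ (j : J) (x : Φ.obj X.left ⟶ P.obj j), x ≫ c.ι.app j = X.hom :=
    IsCardinalPresentable.exists_hom_of_isColimit κ hc X.hom
  rw [isCardinalFiltered_iff]
  constructor
  · intro ι X hι
    choose j x hx using fun i ↦ lift (X i)
    let j' := IsCardinalFiltered.max j hι
    let Y (i : ι) : CostructuredArrow Φ (P.obj j') :=
      CostructuredArrow.mk (Y := (X i).left) (x i ≫ P.map (IsCardinalFiltered.toMax j hι i))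
    refine ⟨(CostructuredArrow.map (c.ι.app j')).obj (IsCardinalFiltered.max Y hι),
      fun i ↦ ⟨CostructuredArrow.homMk (IsCardinalFiltered.toMax Y hι i).left ?_⟩⟩
    have h : Φ.map (IsCardinalFiltered.toMax Y hι i).left ≫
      (IsCardinalFiltered.max Y hι).hom =
        x i ≫ P.map (IsCardinalFiltered.toMax j hι i) :=
      CostructuredArrow.w (IsCardinalFiltered.toMax Y hι i)
    dsimp
    rw [reassoc_of% h, c.w, hx]
  · intro ι X Y f hι
    obtain ⟨j, x, hx⟩ := lift X
    obtain ⟨k, y, hy⟩ := lift Y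
    have h (i : ι) : ∃ (l : J) (a : IsFiltered.max j k ⟶ l),
        (x ≫ P.map (IsFiltered.leftToMax j k)) ≫ P.map a =
        (Φ.map (f i).left ≫ y ≫ P.map (IsFiltered.rightToMax j k)) ≫ P.map a := by
      refine IsCardinalPresentable.exists_eq_of_isColimit' κ hc _ _ ?_
      have := CostructuredArrow.w (f i)
      simp only [Category.assoc, Cocone.w, hx, hy, this]
    choose l a ha using h
    obtain ⟨m, b, b', hb⟩ := IsCardinalFiltered.wideSpan a hι
    let X' : CostructuredArrow Φ (P.obj m) :=
      CostructuredArrow.mk (Y := X.left) (x ≫ P.map (IsFiltered.leftToMax j k) ≫ P.map b')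
    let Y' : CostructuredArrow Φ (P.obj m) :=
      CostructuredArrow.mk (Y := Y.left) (y ≫ P.map (IsFiltered.rightToMax j k) ≫ P.map b')
    let f' (i : ι) : X' ⟶ Y' := CostructuredArrow.homMk (f i).left (by
      have := ha i =≫ P.map (b i)
      simp only [Category.assoc, ← P.map_comp, hb i] at this
      simp only [CostructuredArrow.mk_hom_eq_self, ← P.map_comp, X', Y', this])
    let q := IsCardinalFiltered.coeqHom f' hι
    let q' := IsCardinalFiltered.toCoeq f' hι
    have hq := CostructuredArrow.w q
    have hq' := CostructuredArrow.w q'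
    dsimp [X', Y'] at hq hq'
    refine ⟨(CostructuredArrow.map (c.ι.app m)).obj (IsCardinalFiltered.coeq f' hι),
      CostructuredArrow.homMk q.left ?_, CostructuredArrow.homMk q'.left ?_, fun i ↦ ?_⟩
    · dsimp
      rw [reassoc_of% hq, c.w, c.w, hy]
    · dsimp
      rw [reassoc_of% hq', c.w, c.w, hx]
    · ext
      exact congr_arg (·.left) (IsCardinalFiltered.coeq_condition f' hι i)

lemma exists_small_weakly_terminal_set_costructuredArrow_of_isColimit {Φ : D ⥤ B}
    (hΦ : ∀ X, IsCardinalPresentable (Φ.obj X) κ)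
    {J : Type w} [SmallCategory J] [IsCardinalFiltered J κ] {P : J ⥤ B}
    {c : Cocone P} (hc : IsColimit c)
    (hP : ∀ j, FinallySmall.{w} (CostructuredArrow Φ (P.obj j))) :
    ∃ (s : Set (CostructuredArrow Φ c.pt)) (_ : Small.{w} s), ∀ X, ∃ Y ∈ s, Nonempty (X ⟶ Y) := by
  have := essentiallySmallSelf J
  choose s hs hs' using fun j ↦
    FinallySmall.exists_small_weakly_terminal_set.{w} (CostructuredArrow Φ (P.obj j))
  refine ⟨Set.range fun x : Σ j, s j ↦ (CostructuredArrow.map (c.ι.app x.1)).obj x.2.1,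
    inferInstance, fun X ↦ ?_⟩
  obtain ⟨j, x, hx⟩ := IsCardinalPresentable.exists_hom_of_isColimit κ hc X.hom
  obtain ⟨Y, hY, ⟨f⟩⟩ := hs' j (CostructuredArrow.mk x)
  refine ⟨_, ⟨⟨j, ⟨Y, hY⟩⟩, rfl⟩, ⟨CostructuredArrow.homMk f.left ?_⟩⟩
  have := CostructuredArrow.w f
  dsimp at this ⊢
  rw [reassoc_of% this, hx]

end CostructuredArrow

/-! ### Closure properties of ind-objects among presheaves. -/

section IndCat

variable {C : Type u} [Category.{w} C] (κ : Cardinal.{w}) [Fact κ.IsRegular]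

instance isCardinalPresentable_yoneda (X : C) : IsCardinalPresentable (yoneda.obj X) κ :=
  Functor.isCardinalAccessible_of_natIso
    (show (evaluation Cᵒᵖ (Type w)).obj (op X) ⋙ uliftFunctor.{u} ≅
        coyoneda.obj (op (yoneda.obj X)) from
      NatIso.ofComponents (fun P ↦ (Equiv.ulift.trans yonedaEquiv.symm).toIso) (by
        intro P Q f
        ext ⟨x⟩
        exact (yonedaEquiv_symm_naturality_right X f x).symm)) κ

/-- A presheaf is the colimit of its category of elements. When that category is `κ`-filtered, the
full subcategory on a small weakly terminal set is again `κ`-filtered and is final, hence provides a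
small presentation. This form makes closure under `κ`-filtered colimits accessible. -/
lemma isIndObject_iff (P : Cᵒᵖ ⥤ Type w) :
    isIndObject C κ P ↔ IsCardinalFiltered (CostructuredArrow yoneda P) κ ∧
      FinallySmall.{w} (CostructuredArrow yoneda P) := by
  constructor
  · rintro ⟨p, hp⟩
    exact ⟨IsCardinalFiltered.of_final p.toCostructuredArrow κ,
      FinallySmall.mk' p.toCostructuredArrow⟩
  · rintro ⟨h₁, h₂⟩
    have := isFiltered_of_isCardinalFiltered (CostructuredArrow yoneda P) κ
    obtain ⟨s, hs, hs'⟩ :=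
      FinallySmall.exists_small_weakly_terminal_set.{w} (CostructuredArrow yoneda P)
    let Q : ObjectProperty (CostructuredArrow yoneda P) := (· ∈ s)
    have : Small.{w} Q.FullSubcategory := small_of_injective (β := s)
      (f := fun x ↦ ⟨x.1, x.2⟩) (fun x y h ↦ by cases x; cases y; simp_all)
    have : EssentiallySmall.{w} Q.FullSubcategory := essentiallySmall_of_small_of_locallySmall _
    let J := SmallModel.{w} Q.FullSubcategory
    let i : J ⥤ CostructuredArrow yoneda P := (equivSmallModel Q.FullSubcategory).inverse ⋙ Q.ι
    have hi (k) : ∃ j : J, Nonempty (k ⟶ i.obj j) := by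
      obtain ⟨Y, hY, ⟨f⟩⟩ := hs' k
      exact ⟨(equivSmallModel Q.FullSubcategory).functor.obj ⟨Y, hY⟩,
        ⟨f ≫ Q.ι.map ((equivSmallModel Q.FullSubcategory).unit.app ⟨Y, hY⟩)⟩⟩
    have := isCardinalFiltered_of_fullyFaithful (κ := κ) i hi
    have := isFiltered_of_isCardinalFiltered J κ
    have : i.Final := Functor.final_of_exists_of_isFiltered_of_fullyFaithful i hi
    exact ⟨
      { I := J
        F := i ⋙ CostructuredArrow.proj yoneda P
        ι := ((Presheaf.tautologicalCocone P).whisker i).ι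
        isColimit := (Functor.Final.isColimitWhiskerEquiv i _).symm
          (Presheaf.isColimitTautologicalCocone P) }, ‹_›⟩

lemma isIndObject_of_isColimit {J : Type w} [SmallCategory J] [IsCardinalFiltered J κ]
    {P : J ⥤ Cᵒᵖ ⥤ Type w} {c : Cocone P} (hc : IsColimit c)
    (hP : ∀ j, isIndObject C κ (P.obj j)) : isIndObject C κ c.pt := by
  have : IsCardinalFiltered (CostructuredArrow yoneda c.pt) κ :=
    isCardinalFiltered_costructuredArrow_of_isColimit (κ := κ)
      (fun _ ↦ inferInstance) hc fun j ↦ ((isIndObject_iff κ _).1 (hP j)).1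
  refine (isIndObject_iff κ _).2 ⟨this, ?_⟩
  have := isFiltered_of_isCardinalFiltered (CostructuredArrow yoneda c.pt) κ
  rw [finallySmall_iff_exists_small_weakly_terminal_set]
  exact exists_small_weakly_terminal_set_costructuredArrow_of_isColimit (κ := κ)
    (fun _ ↦ inferInstance) hc fun j ↦ ((isIndObject_iff κ _).1 (hP j)).2

instance isClosedUnderColimitsOfShape_isIndObject (J : Type w) [SmallCategory J]
    [IsCardinalFiltered J κ] : (isIndObject C κ).IsClosedUnderColimitsOfShape J where
  colimitsOfShape_le := by
    rintro X ⟨h⟩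
    exact isIndObject_of_isColimit κ h.isColimit h.prop_diag_obj

instance hasCardinalFilteredColimits_indCat : HasCardinalFilteredColimits (IndCat C κ) κ where
  hasColimitsOfShape _ _ _ := inferInstance

instance isCardinalAccessible_ι : (isIndObject C κ).ι.IsCardinalAccessible κ where
  preservesColimitOfShape _ _ _ := inferInstance

theorem isIndEmbedding_toInd : IsIndEmbedding (toInd C κ) κ where
  full := inferInstance
  faithful := inferInstance
  isCardinalPresentable X :=
    Functor.isCardinalAccessible_of_natIso
      (show (isIndObject C κ).ι ⋙ coyoneda.obj (op (yoneda.obj X)) ≅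
          coyoneda.obj (op ((toInd C κ).obj X)) from
        NatIso.ofComponents fun P ↦
          ((isIndObject C κ).fullyFaithfulι.homEquiv (X := (toInd C κ).obj X)).symm.toIso) κ
  exists_isColimit P := by
    obtain ⟨p, hp⟩ := P.property
    exact ⟨p.I, inferInstance, hp, p.F,
      { app j := ObjectProperty.homMk (p.ι.app j)
        naturality i j f := ObjectProperty.hom_ext _ (p.ι.naturality f) },
      ⟨isColimitOfReflects (isIndObject C κ).ι p.isColimit⟩⟩

end IndCat

/-! ### The comparison functor as an instance of the recognition principle. -/

section Comparison

section

variable {C : Type u₁} [Category.{w} C] {D : Type u₂} [Category.{w} D]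
  (κ : Cardinal.{w}) [Fact κ.IsRegular]

instance isIso_indMapUnit (G : C ⥤ D) : IsIso (indMapUnit κ G) :=
  ((toInd C κ).pointwiseLeftKanExtensionIsPointwiseLeftKanExtension (G ⋙ toInd D κ)).isIso_hom

/-- The index category of the diagram is final in the comma category over its colimit, and the
pointwise Kan extension is a colimit over that comma category. -/
instance preservesColimit_indMap (G : C ⥤ D) {J : Type w} [SmallCategory J]
    [IsCardinalFiltered J κ] (F : J ⥤ C) : PreservesColimit (F ⋙ toInd C κ) (indMap κ G) where
  preserves {c} hc := by
    have := final_coconeToCostructuredArrow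
      (isIndEmbedding_toInd (C := C) κ).isCardinalPresentable hc
    have h := (Functor.Final.isColimitWhiskerEquiv (coconeToCostructuredArrow c) _).symm
      ((toInd C κ).pointwiseLeftKanExtensionIsPointwiseLeftKanExtension (G ⋙ toInd D κ) c.pt)
    let e : F ⋙ toInd C κ ⋙ indMap κ G ≅ F ⋙ G ⋙ toInd D κ :=
      (Functor.isoWhiskerLeft F (asIso (indMapUnit κ G))).symm
    refine ⟨IsColimit.ofIsoColimit ((IsColimit.precomposeHomEquiv e _).symm h)
      (Cocone.ext (Iso.refl _) fun j ↦ ?_)⟩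
    change ((inv (indMapUnit κ G)).app (F.obj j) ≫ (indMapUnit κ G).app (F.obj j) ≫
      (indMap κ G).map (c.ι.app j)) ≫ 𝟙 _ = (indMap κ G).map (c.ι.app j)
    rw [Category.comp_id, ← NatTrans.comp_app_assoc, IsIso.inv_hom_id, NatTrans.id_app]
    exact Category.id_comp _

end

variable (I : Type w) [SmallCategory I] (C : Type u) [Category.{w} C]
  (κ : Cardinal.{w}) [Fact κ.IsRegular]

/-- On diagrams in `C`, the comparison functor is the pointwise embedding. -/
noncomputable def toIndCompComparison :
    toInd (I ⥤ C) κ ⋙ comparison I C κ ≅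
      (Functor.whiskeringRight I C (IndCat C κ)).obj (toInd C κ) :=
  Iso.symm (NatIso.ofComponents
    (fun X ↦ NatIso.ofComponents
      (fun i ↦ (asIso (indMapUnit κ ((evaluation I C).obj i))).app X)
      (fun {i j} f ↦ ((indMap κ ((evaluation I C).obj i)).descOfIsLeftKanExtension_fac_app
        (indMapUnit κ _) (indMap κ ((evaluation I C).obj j))
        (Functor.whiskerRight ((evaluation I C).map f) (toInd C κ) ≫ indMapUnit κ _) X).symm))
    (fun f ↦ by
      ext i : 2
      exact (indMapUnit κ ((evaluation I C).obj i)).naturality f))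

instance preservesColimit_comparison {J : Type w} [SmallCategory J]
    [IsCardinalFiltered J κ] (F : J ⥤ I ⥤ C) :
    PreservesColimit (F ⋙ toInd (I ⥤ C) κ) (comparison I C κ) :=
  preservesColimit_of_evaluation _ _ fun i ↦
    inferInstanceAs (PreservesColimit (F ⋙ toInd (I ⥤ C) κ) (indMap κ ((evaluation I C).obj i)))

theorem isEquivalence_comparison_iff :
    (comparison I C κ).IsEquivalence ↔
      IsIndEmbedding ((Functor.whiskeringRight I C (IndCat C κ)).obj (toInd C κ)) κ := by
  constructor
  · intro
    exact ((isIndEmbedding_toInd (C := I ⥤ C) κ).comp_isEquivalence _).of_iso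
      (toIndCompComparison I C κ)
  · intro h
    exact (isIndEmbedding_toInd (C := I ⥤ C) κ).isEquivalence _
      (h.of_iso (toIndCompComparison I C κ).symm) (fun _ _ _ F ↦ hasColimit_toInd κ F)
      (fun _ _ _ F ↦ inferInstance)

end Comparison

/-- The recursion passes on only the earlier data, not the proofs that they satisfy `R`. So each
value is picked by `Classical.epsilon`, meaningful or not, and `R` is established afterwards by
induction. -/
lemma exists_forall_of_wellFounded {ι : Type u₁} {r : ι → ι → Prop} (hr : WellFounded r)
    {T : ι → Type u₂} [∀ i, Nonempty (T i)] (R : ∀ i, (∀ j, r j i → T j) → T i → Prop)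
    (h : ∀ i (t : ∀ j, T j), (∀ j, r j i → R j (fun k _ ↦ t k) (t j)) →
      ∃ x, R i (fun j _ ↦ t j) x) :
    ∃ t : ∀ i, T i, ∀ i, R i (fun j _ ↦ t j) (t i) := by
  let t : ∀ i, T i := hr.fix fun i prev ↦ Classical.epsilon (R i prev)
  have ht (i : ι) : t i = Classical.epsilon (R i fun j _ ↦ t j) := hr.fix_eq _ i
  refine ⟨t, fun i ↦ hr.induction (C := fun i ↦ R i (fun j _ ↦ t j) (t i)) i fun i hi ↦ ?_⟩
  have := Classical.epsilon_spec (h i t hi)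
  rwa [← ht i] at this

/-! ### Recursive construction of functors lying over a given functor. -/

section

variable {I : Type u₃} [Category.{v₃} I] {C : Type u₁} [Category.{v₁} C] {B : Type u₂}
  [Category.{v₂} B] {Φ : C ⥤ B} {F : I ⥤ B}

variable (Φ F) in
/-- The category of functors `X : I ⥤ C` equipped with a natural transformation
from `X ⋙ Φ` to `F`. -/
abbrev FunctorCostructuredArrow :=
  CostructuredArrow ((Functor.whiskeringRight I C B).obj Φ) F

variable (Φ F) in
/-- Evaluation of costructured arrows in functor categories. -/
def evaluationCostructuredArrow (i : I) :
    FunctorCostructuredArrow Φ F ⥤ CostructuredArrow Φ (F.obj i) where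
  obj Z := CostructuredArrow.mk (Y := Z.left.obj i) (Z.hom.app i)
  map f := CostructuredArrow.homMk (f.left.app i)
    (NatTrans.congr_app (CostructuredArrow.w f) i)

/-- The data constructed at the stage `i` of the recursion: an object over `F.obj i`,
receiving a map from a given object, together with partially defined maps from all objects
lying over the `F.obj j` for all `j ⟶ i`. -/
structure ExtensionStage {i : I} (W : CostructuredArrow Φ (F.obj i)) where
  /-- the object over `F.obj i` -/
  obj : CostructuredArrow Φ (F.obj i)
  /-- the map from the given object -/
  hom : W ⟶ obj
  /-- the transition maps -/
  trans : ∀ (j : I) (f : j ⟶ i) (X : CostructuredArrow Φ (F.obj j)),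
    Option ((CostructuredArrow.map (F.map f)).obj X ⟶ obj)

instance {i : I} (W : CostructuredArrow Φ (F.obj i)) : Nonempty (ExtensionStage W) :=
  ⟨⟨W, 𝟙 W, fun _ _ _ ↦ none⟩⟩

/-- The compatibilities satisfied by the data at stage `i`, with respect to previous stages. -/
structure ExtensionStage.Compatible {A : Type u₄} [Category.{v₄} A]
    {Z : A ⥤ FunctorCostructuredArrow Φ F}
    (W : ∀ i, Cocone (Z ⋙ evaluationCostructuredArrow Φ F i)) {i : I}
    (prev : ∀ j, Nonempty (j ⟶ i) ∧ j ≠ i → ExtensionStage (W j).pt)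
    (x : ExtensionStage (W i).pt)
    (μ : ∀ (j : I) (f : j ⟶ i) (h : j ≠ i),
      (CostructuredArrow.map (F.map f)).obj (prev j ⟨⟨f⟩, h⟩).obj ⟶ x.obj) : Prop where
  trans_eq (j : I) (f : j ⟶ i) (h : j ≠ i) :
    x.trans j f (prev j ⟨⟨f⟩, h⟩).obj = some (μ j f h)
  comp_eq (k j : I) (g : k ⟶ j) (f : j ⟶ i) (hkj : k ≠ j) (hji : j ≠ i) (hki : k ≠ i)
    (μ' : (CostructuredArrow.map (F.map g)).obj (prev k ⟨⟨g ≫ f⟩, hki⟩).obj ⟶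
      (prev j ⟨⟨f⟩, hji⟩).obj)
    (hμ' : (prev j ⟨⟨f⟩, hji⟩).trans k g (prev k ⟨⟨g ≫ f⟩, hki⟩).obj = some μ') :
    (μ k (g ≫ f) hki).left = μ'.left ≫ (μ j f hji).left
  hom_comp_eq (j : I) (f : j ⟶ i) (h : j ≠ i) (a : A) :
    (Z.obj a).left.map f ≫ ((W i).ι.app a).left ≫ x.hom.left =
      ((W j).ι.app a).left ≫ (prev j ⟨⟨f⟩, h⟩).hom.left ≫ (μ j f h).left

variable {κ : Cardinal.{w}} [Fact κ.IsRegular]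

omit [Fact κ.IsRegular] in
lemma hasCardinalLT_hom_of_arrow (hI : HasCardinalLT (Arrow I) κ) (i j : I) :
    HasCardinalLT (i ⟶ j) κ :=
  hI.of_injective (fun f ↦ Arrow.mk f) fun f g h ↦ by
    simpa using (Arrow.mk_inj i j).1 h

/-- One step of the recursion: in a `κ`-filtered category, bound all earlier stages together with `W
i`, then coequalize the fewer than `κ` pairs expressing functoriality and naturality. -/
lemma exists_compatible_extensionStage {A : Type u₄} [Category.{v₄} A]
    (hI : HasCardinalLT (Arrow I) κ)
    (hA : HasCardinalLT (Arrow A) κ)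
    (hwf : WellFounded fun i j : I ↦ Nonempty (i ⟶ j) ∧ i ≠ j)
    [∀ i, IsCardinalFiltered (CostructuredArrow Φ (F.obj i)) κ]
    {Z : A ⥤ FunctorCostructuredArrow Φ F}
    (W : ∀ i, Cocone (Z ⋙ evaluationCostructuredArrow Φ F i)) (i : I)
    (t : ∀ j, ExtensionStage (W j).pt)
    (ht : ∀ j, Nonempty (j ⟶ i) ∧ j ≠ i →
      ∃ μ, ExtensionStage.Compatible W (fun k _ ↦ t k) (t j) μ) :
    ∃ x μ, ExtensionStage.Compatible W (i := i) (fun k _ ↦ t k) x μ := by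
  classical
  have := isFiltered_of_isCardinalFiltered (CostructuredArrow Φ (F.obj i)) κ
  have hI₀ : HasCardinalLT I κ := hasCardinalLT_of_hasCardinalLT_arrow hI
  have hκ : Cardinal.aleph0 ≤ κ := Cardinal.IsRegular.aleph0_le Fact.out
  have hsub {X Y : I} (p : Prop) : HasCardinalLT {f : X ⟶ Y // p} κ :=
    (hasCardinalLT_hom_of_arrow hI X Y).of_injective _ Subtype.val_injective
  choose μ' hμ' using ht
  -- A composite of two arrows between distinct objects cannot return to its source, since this
  -- would be a cycle for a well-founded relation.
  have hne {k j : I} (g : k ⟶ j) (f : j ⟶ i) (hkj : k ≠ j) (hji : j ≠ i) : k ≠ i := by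
    rintro rfl
    exact hwf.asymmetric _ _ ⟨⟨g⟩, hkj⟩ ⟨⟨f⟩, hji⟩
  let S := Σ j, {_f : j ⟶ i // j ≠ i}
  have hS : HasCardinalLT S κ := hasCardinalLT_sigma _ _ hI₀ fun _ ↦ hsub _
  let X (s : S) : CostructuredArrow Φ (F.obj i) :=
    (CostructuredArrow.map (F.map s.2.1)).obj (t s.1).obj
  let n₀ : CostructuredArrow Φ (F.obj i) :=
    IsFiltered.max (IsCardinalFiltered.max X hS) (W i).pt
  let m (s : S) : X s ⟶ n₀ := IsCardinalFiltered.toMax X hS s ≫ IsFiltered.leftToMax _ _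
  let ν : (W i).pt ⟶ n₀ := IsFiltered.rightToMax _ _
  -- `P₁` indexes the equations for composable pairs `k ⟶ j ⟶ i`, and `P₂` the naturality squares of
  -- the maps from the `Z.obj a`.
  let P₁ := Σ s : S, Σ k, {_g : k ⟶ s.1 // k ≠ s.1}
  let P₂ := S × A
  have hP : HasCardinalLT (P₁ ⊕ P₂) κ := by
    rw [hasCardinalLT_sum_iff _ _ _ hκ]
    exact ⟨hasCardinalLT_sigma _ _ hS fun _ ↦ hasCardinalLT_sigma _ _ hI₀ fun _ ↦ hsub _,
      hasCardinalLT_prod hκ hS (hasCardinalLT_of_hasCardinalLT_arrow hA)⟩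
  let X₁ (p : P₁) : CostructuredArrow Φ (F.obj i) :=
    X ⟨p.2.1, p.2.2.1 ≫ p.1.2.1, hne p.2.2.1 p.1.2.1 p.2.2.2 p.1.2.2⟩
  let X₂ (p : P₂) : CostructuredArrow Φ (F.obj i) :=
    (CostructuredArrow.map (F.map p.1.2.1)).obj
      ((evaluationCostructuredArrow Φ F p.1.1).obj (Z.obj p.2))
  let φ₁ (p : P₁) : X₁ p ⟶ X p.1 :=
    CostructuredArrow.homMk (μ' p.1.1 ⟨⟨p.1.2.1⟩, p.1.2.2⟩ p.2.1 p.2.2.1 p.2.2.2).left (by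
      have := CostructuredArrow.w (μ' p.1.1 ⟨⟨p.1.2.1⟩, p.1.2.2⟩ p.2.1 p.2.2.1 p.2.2.2)
      dsimp [X₁, X] at this ⊢
      rw [reassoc_of% this, F.map_comp])
  let φ₂ (p : P₂) : X₂ p ⟶ (evaluationCostructuredArrow Φ F i).obj (Z.obj p.2) :=
    CostructuredArrow.homMk ((Z.obj p.2).left.map p.1.2.1)
      ((Z.obj p.2).hom.naturality p.1.2.1)
  let src : P₁ ⊕ P₂ → CostructuredArrow Φ (F.obj i) := Sum.elim X₁ X₂
  let f₁ : ∀ p, src p ⟶ n₀ := Sum.rec (fun p ↦ m _) (fun p ↦ φ₂ p ≫ (W i).ι.app p.2 ≫ ν)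
  let f₂ : ∀ p, src p ⟶ n₀ := Sum.rec (fun p ↦ φ₁ p ≫ m p.1)
    (fun p ↦ (CostructuredArrow.map (F.map p.1.2.1)).map
      ((W p.1.1).ι.app p.2 ≫ (t p.1.1).hom) ≫ m p.1)
  obtain ⟨n, a, ha⟩ := IsCardinalFiltered.multicoequalizer f₁ f₂ hP
  let M (j : I) (f : j ⟶ i) (h : j ≠ i) :
      (CostructuredArrow.map (F.map f)).obj (t j).obj ⟶ n := m ⟨j, f, h⟩ ≫ a
  refine ⟨{
    obj := n
    hom := ν ≫ a
    trans j f Y := if h : j ≠ i ∧ Y = (t j).obj then some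
      (eqToHom (by rw [h.2]) ≫ M j f h.1) else none }, M, ?_, ?_, ?_⟩
  · intro j f h
    dsimp
    rw [dif_pos ⟨h, rfl⟩]
    simp
  · intro k j g f hkj hji hki μ'' h''
    rw [(hμ' j ⟨⟨f⟩, hji⟩).trans_eq k g hkj] at h''
    obtain rfl := Option.some_injective _ h''
    have := congr_arg (·.left) (ha (Sum.inl ⟨⟨j, f, hji⟩, k, g, hkj⟩))
    exact this.trans (Category.assoc _ _ _)
  · intro j f h x
    have := congr_arg (·.left) (ha (Sum.inr ⟨⟨j, f, h⟩, x⟩))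
    exact ((Category.assoc _ _ _).trans (congr_arg _ (Category.assoc _ _ _))).symm.trans
      (this.trans ((Category.assoc _ _ _).trans (Category.assoc _ _ _)))

variable [∀ i, IsCardinalFiltered (CostructuredArrow Φ (F.obj i)) κ]

/-- The prescribed cocones `W i` serve twice: arbitrary ones give `κ`-filteredness, and a special
choice at one object gives finality of evaluation. -/
lemma exists_cocone_functorCostructuredArrow {A : Type u₄} [Category.{v₄} A]
    (hI : HasCardinalLT (Arrow I) κ) (hA : HasCardinalLT (Arrow A) κ)
    (hid : ∀ (i : I) (f : i ⟶ i), f = 𝟙 i)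
    (hwf : WellFounded fun i j : I ↦ Nonempty (i ⟶ j) ∧ i ≠ j)
    {Z : A ⥤ FunctorCostructuredArrow Φ F}
    (W : ∀ i, Cocone (Z ⋙ evaluationCostructuredArrow Φ F i)) :
    ∃ (c : Cocone Z) (ν : ∀ i, (W i).pt ⟶ (evaluationCostructuredArrow Φ F i).obj c.pt),
      ∀ i a, (W i).ι.app a ≫ ν i = (evaluationCostructuredArrow Φ F i).map (c.ι.app a) := by
  classical
  obtain ⟨t, ht⟩ := exists_forall_of_wellFounded hwf
    (T := fun i ↦ ExtensionStage (W i).pt)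
    (fun i prev x ↦ ∃ μ, ExtensionStage.Compatible W prev x μ)
    (exists_compatible_extensionStage hI hA hwf W)
  choose μ hμ using ht
  have hne {k j i : I} (g : k ⟶ j) (f : j ⟶ i) (hkj : k ≠ j) (hji : j ≠ i) : k ≠ i := by
    rintro rfl
    exact hwf.asymmetric _ _ ⟨⟨g⟩, hkj⟩ ⟨⟨f⟩, hji⟩
  -- The recursion yields maps only for `j ≠ i`. The remaining arrows are endomorphisms, hence
  -- identities, and are sent to identities.
  let m {j i : I} (f : j ⟶ i) : (t j).obj.left ⟶ (t i).obj.left :=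
    if h : j = i then eqToHom (by rw [h]) else (μ i j f h).left
  have m_id (i : I) (f : i ⟶ i) : m f = 𝟙 _ := by simp [m]
  have m_of_ne {j i : I} (f : j ⟶ i) (h : j ≠ i) : m f = (μ i j f h).left := by simp [m, h]
  let X : I ⥤ C :=
    { obj i := (t i).obj.left
      map f := m f
      map_id i := m_id i _
      map_comp {k j i} g f := by
        by_cases hkj : k = j
        · subst hkj
          rw [m_id, hid _ g, Category.id_comp, Category.id_comp]
        by_cases hji : j = i
        · subst hji
          rw [m_id _ f, hid _ f, Category.comp_id, Category.comp_id]
        rw [m_of_ne _ hkj, m_of_ne _ hji, m_of_ne _ (hne g f hkj hji)]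
        exact (hμ i).comp_eq k j g f hkj hji (hne g f hkj hji) (μ j k g hkj)
          ((hμ j).trans_eq k g hkj) }
  let x : FunctorCostructuredArrow Φ F := CostructuredArrow.mk (Y := X)
    { app i := (t i).obj.hom
      naturality j i f := by
        change Φ.map (m f) ≫ (t i).obj.hom = (t j).obj.hom ≫ F.map f
        by_cases h : j = i
        · subst h
          rw [m_id _ f, hid _ f, Φ.map_id, F.map_id, Category.id_comp, Category.comp_id]
        · rw [m_of_ne _ h]
          exact CostructuredArrow.w (μ i j f h) }
  let q (a : A) (i : I) : (Z.obj a).left.obj i ⟶ (t i).obj.left :=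
    ((W i).ι.app a).left ≫ (t i).hom.left
  have hq {j i : I} (f : j ⟶ i) (h : j ≠ i) (a : A) :
      (Z.obj a).left.map f ≫ q a i = q a j ≫ (μ i j f h).left :=
    ((hμ i).hom_comp_eq j f h a).trans (Category.assoc _ _ _).symm
  let ι (a : A) : Z.obj a ⟶ x := CostructuredArrow.homMk
    { app i := q a i
      naturality j i f := by
        change _ ≫ q a i = q a j ≫ m f
        by_cases h : j = i
        · subst h
          rw [m_id _ f, hid _ f, CategoryTheory.Functor.map_id, Category.id_comp, Category.comp_id]
        · rw [m_of_ne _ h]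
          exact hq f h a } (by
      ext i
      exact CostructuredArrow.w ((W i).ι.app a ≫ (t i).hom))
  refine ⟨{ pt := x, ι := { app := ι, naturality := fun a b f ↦ ?_ } },
    fun i ↦ (t i).hom, fun i a ↦ rfl⟩
  ext i
  have := congr_arg (·.left) ((W i).w f) =≫ (t i).hom.left
  exact (Category.assoc _ _ _).symm.trans (this.trans (Category.comp_id _).symm)

lemma isCardinalFiltered_functorCostructuredArrow
    (hI : HasCardinalLT (Arrow I) κ)
    (hid : ∀ (i : I) (f : i ⟶ i), f = 𝟙 i)
    (hwf : WellFounded fun i j : I ↦ Nonempty (i ⟶ j) ∧ i ≠ j) :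
    IsCardinalFiltered (FunctorCostructuredArrow Φ F) κ where
  nonempty_cocone Z hA := by
    obtain ⟨c, _, _⟩ := exists_cocone_functorCostructuredArrow hI hA hid hwf
      (fun i ↦ IsCardinalFiltered.cocone (Z ⋙ evaluationCostructuredArrow Φ F i) hA)
    exact ⟨c⟩

lemma exists_hom_functorCostructuredArrow
    (hI : HasCardinalLT (Arrow I) κ)
    (hid : ∀ (i : I) (f : i ⟶ i), f = 𝟙 i)
    (hwf : WellFounded fun i j : I ↦ Nonempty (i ⟶ j) ∧ i ≠ j)
    (Z : FunctorCostructuredArrow Φ F) (i : I) {W : CostructuredArrow Φ (F.obj i)}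
    (φ : (evaluationCostructuredArrow Φ F i).obj Z ⟶ W) :
    ∃ (X : FunctorCostructuredArrow Φ F) (ι : Z ⟶ X)
      (ν : W ⟶ (evaluationCostructuredArrow Φ F i).obj X),
        φ ≫ ν = (evaluationCostructuredArrow Φ F i).map ι := by
  classical
  let T (j : I) := Under ((evaluationCostructuredArrow Φ F j).obj Z)
  -- The arrow to be absorbed is prescribed at `i`, and identities at all other objects.
  let U : ∀ j, T j := Function.update (fun j ↦ Under.mk (𝟙 _)) i (Under.mk φ)
  have hU : U i = Under.mk φ := Function.update_self _ _ _
  obtain ⟨c, ν, h⟩ := exists_cocone_functorCostructuredArrow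
    (A := Discrete PUnit.{w + 1}) (Z := (Functor.const _).obj Z) (κ := κ) hI
    (hasCardinalLT_of_finite _ _ (Cardinal.IsRegular.aleph0_le Fact.out)) hid hwf
    (fun j ↦ { pt := (U j).right, ι := { app _ := (U j).hom } })
  have h' := h i ⟨⟨⟩⟩
  have h'' : ∃ ν' : (U i).right ⟶ (evaluationCostructuredArrow Φ F i).obj c.pt,
    (U i).hom ≫ ν' = (evaluationCostructuredArrow Φ F i).map (c.ι.app ⟨⟨⟩⟩) := ⟨ν i, h'⟩
  rw [hU] at h''
  obtain ⟨ν', h''⟩ := h''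
  exact ⟨c.pt, c.ι.app ⟨⟨⟩⟩, ν', h''⟩

lemma final_evaluationCostructuredArrow
    (hI : HasCardinalLT (Arrow I) κ)
    (hid : ∀ (i : I) (f : i ⟶ i), f = 𝟙 i)
    (hwf : WellFounded fun i j : I ↦ Nonempty (i ⟶ j) ∧ i ≠ j) (i : I) :
    (evaluationCostructuredArrow Φ F i).Final := by
  have := isCardinalFiltered_functorCostructuredArrow (Φ := Φ) (F := F) hI hid hwf
  have := isFiltered_of_isCardinalFiltered (FunctorCostructuredArrow Φ F) κ
  have := isFiltered_of_isCardinalFiltered (CostructuredArrow Φ (F.obj i)) κ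
  rw [Functor.final_iff_of_isFiltered]
  refine ⟨fun Y ↦ ?_, fun {Y Z} f g ↦ ?_⟩
  · have := IsFiltered.nonempty (C := FunctorCostructuredArrow Φ F)
    obtain ⟨X, _, ν, _⟩ := exists_hom_functorCostructuredArrow hI hid hwf
      (Classical.arbitrary (FunctorCostructuredArrow Φ F)) i
      (IsFiltered.leftToMax _ Y)
    exact ⟨X, ⟨IsFiltered.rightToMax _ Y ≫ ν⟩⟩
  · obtain ⟨X, ι, ν, h⟩ := exists_hom_functorCostructuredArrow hI hid hwf Z i
      (IsFiltered.coeqHom f g)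
    exact ⟨X, ι, by rw [← h, IsFiltered.coeq_condition_assoc]⟩

end

/-! ### Canonical colimits. -/

section Tautological

variable {D : Type u₁} [Category.{v₁} D] {B : Type u₂} [Category.{v₂} B]

/-- The canonical cocone with point `Y`, indexed by the arrows `Φ.obj X ⟶ Y`. -/
def tautologicalCocone (Φ : D ⥤ B) (Y : B) : Cocone (CostructuredArrow.proj Φ Y ⋙ Φ) where
  pt := Y
  ι :=
    { app f := f.hom
      naturality _ _ φ := (CostructuredArrow.w φ).trans (Category.comp_id _).symm }

lemma nonempty_isColimit_tautologicalCocone {Φ : D ⥤ B} {J : Type u₃} [Category.{v₃} J]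
    {F : J ⥤ D} {c : Cocone (F ⋙ Φ)} (hc : IsColimit c)
    [(coconeToCostructuredArrow c).Final] :
    Nonempty (IsColimit (tautologicalCocone Φ c.pt)) :=
  ⟨(Functor.Final.isColimitWhiskerEquiv (coconeToCostructuredArrow c) _).1
    (IsColimit.ofIsoColimit hc (Cocone.ext (Iso.refl _) fun _ ↦ Category.comp_id _))⟩

end Tautological

/-! ### Presentable functors and the pointwise embedding. -/

section FunctorCategory

variable {B : Type u₂} [Category.{v₂} B] {κ : Cardinal.{w}} [Fact κ.IsRegular]
  [HasCardinalFilteredColimits B κ]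

/-- The components of a transformation into a `κ`-filtered colimit factor through a common stage,
and the fewer than `κ` naturality squares commute at a later one. -/
lemma isCardinalPresentable_functor {I : Type u₃} [Category.{v₃} I]
    (hI : HasCardinalLT (Arrow I) κ) (F : I ⥤ B) (hF : ∀ i, IsCardinalPresentable (F.obj i) κ) :
    IsCardinalPresentable F κ where
  preservesColimitOfShape J _ _ := ⟨fun {P} ↦ ⟨fun {c} hc ↦ ⟨by
    have := isFiltered_of_isCardinalFiltered J κ
    have := essentiallySmallSelf J
    have := HasCardinalFilteredColimits.hasColimitsOfShape B κ J
    have hI₀ : HasCardinalLT I κ := hasCardinalLT_of_hasCardinalLT_arrow hI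
    have hc' (i : I) := isColimitOfPreserves ((evaluation I B).obj i) hc
    refine Types.FilteredColimit.isColimitOf' _ _ (fun f ↦ ?_) (fun j f₁ f₂ h ↦ ?_)
    · let φ : F ⟶ c.pt := f
      obtain ⟨j₀, g₀, hg₀⟩ : ∃ (j₀ : J) (g₀ : ∀ i, F.obj i ⟶ (P.obj j₀).obj i),
          ∀ i, g₀ i ≫ (c.ι.app j₀).app i = φ.app i := by
        choose j g hg using fun i ↦
          IsCardinalPresentable.exists_hom_of_isColimit κ (hc' i) (φ.app i)
        refine ⟨IsCardinalFiltered.max j hI₀,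
          fun i ↦ g i ≫ (P.map (IsCardinalFiltered.toMax j hI₀ i)).app i, fun i ↦ ?_⟩
        rw [← hg, Category.assoc, ← NatTrans.comp_app, c.w]
        rfl
      have H' (a : Arrow I) : ∃ (k : J) (u : j₀ ⟶ k),
          (g₀ a.left ≫ (P.obj j₀).map a.hom) ≫ (P.map u).app a.right =
            (F.map a.hom ≫ g₀ a.right) ≫ (P.map u).app a.right :=
        IsCardinalPresentable.exists_eq_of_isColimit' κ (hc' a.right) _ _ (by
          change (g₀ a.left ≫ (P.obj j₀).map a.hom) ≫ (c.ι.app j₀).app a.right =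
            (F.map a.hom ≫ g₀ a.right) ≫ (c.ι.app j₀).app a.right
          rw [Category.assoc, Category.assoc, hg₀, NatTrans.naturality, ← Category.assoc, hg₀]
          exact (φ.naturality a.hom).symm)
      choose k u hu using H'
      obtain ⟨m, v, b, hb⟩ := IsCardinalFiltered.wideSpan u hI
      refine ⟨m,
        { app i := g₀ i ≫ (P.map b).app i
          naturality i i' a := ?_ }, ?_⟩
      · have := hu (Arrow.mk a) =≫ (P.map (v (Arrow.mk a))).app i'
        simp only [Category.assoc, ← NatTrans.comp_app, ← P.map_comp, hb (Arrow.mk a),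
          Arrow.mk_left, Arrow.mk_right, Arrow.mk_hom] at this
        change F.map a ≫ g₀ i' ≫ (P.map b).app i' = (g₀ i ≫ (P.map b).app i) ≫ (P.obj m).map a
        rw [Category.assoc, ← this, NatTrans.naturality]
      · refine NatTrans.ext (funext fun i ↦ ?_)
        change φ.app i = (g₀ i ≫ (P.map b).app i) ≫ (c.ι.app m).app i
        rw [Category.assoc, ← NatTrans.comp_app, c.w, hg₀]
    · let φ₁ : F ⟶ P.obj j := f₁
      let φ₂ : F ⟶ P.obj j := f₂
      replace h : φ₁ ≫ c.ι.app j = φ₂ ≫ c.ι.app j := h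
      have H (i : I) : ∃ (k : J) (u : j ⟶ k),
          φ₁.app i ≫ (P.map u).app i = φ₂.app i ≫ (P.map u).app i :=
        IsCardinalPresentable.exists_eq_of_isColimit' κ (hc' i) (φ₁.app i) (φ₂.app i)
          (NatTrans.congr_app h i)
      choose k u hu using H
      obtain ⟨m, v, b, hb⟩ := IsCardinalFiltered.wideSpan u hI₀
      refine ⟨m, b, NatTrans.ext (funext fun i ↦ ?_)⟩
      change φ₁.app i ≫ (P.map b).app i = φ₂.app i ≫ (P.map b).app i
      have := hu i =≫ (P.map (v i)).app i
      rwa [Category.assoc, Category.assoc, ← NatTrans.comp_app, ← P.map_comp, hb] at this⟩⟩⟩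

theorem IsIndEmbedding.whiskeringRight_of_skeletal {C : Type u₁} [Category.{w} C] {Φ : C ⥤ B}
    (h : IsIndEmbedding Φ κ) {I : Type w} [SmallCategory I]
    (hI : HasCardinalLT (Arrow I) κ)
    (hid : ∀ (i : I) (f : i ⟶ i), f = 𝟙 i)
    (hwf : WellFounded fun i j : I ↦ Nonempty (i ⟶ j) ∧ i ≠ j) :
    IsIndEmbedding ((Functor.whiskeringRight I C B).obj Φ) κ where
  full := have := h.full; have := h.faithful; inferInstance
  faithful := have := h.faithful; inferInstance
  isCardinalPresentable X :=
    isCardinalPresentable_functor hI _ fun i ↦ h.isCardinalPresentable (X.obj i)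
  exists_isColimit F := by
    have := h.full
    have := h.faithful
    have := h.locallySmall
    choose J _ _ G α hα using fun i ↦ h.exists_isColimit (F.obj i)
    -- Only the objects occurring in chosen presentations of the `F.obj i` are kept. This makes the
    -- category of functors over `F` essentially small, and the presentations still map finally to
    -- the restricted comma categories.
    let ψ (s : Σ i, J i) : C := (G s.1).obj s.2
    let Ψ := inducedFunctor ψ
    let G' (i : I) : J i ⥤ InducedCategory C ψ :=
      { obj j := (⟨i, j⟩ : Σ i, J i)
        map f := InducedCategory.homMk ((G i).map f) }
    let c (i : I) : Cocone (G' i ⋙ Ψ ⋙ Φ) :=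
      { pt := F.obj i
        ι :=
          { app j := (α i).app j
            naturality _ _ f := (α i).naturality f } }
    let hc (i : I) : IsColimit (c i) := (hα i).some
    have hF (i : I) : (coconeToCostructuredArrow (c i)).Final :=
      final_coconeToCostructuredArrow (Φ := Ψ ⋙ Φ) (fun s ↦ h.isCardinalPresentable (ψ s)) (hc i)
    have (i : I) : IsCardinalFiltered (CostructuredArrow (Ψ ⋙ Φ) (F.obj i)) κ :=
      IsCardinalFiltered.of_final (coconeToCostructuredArrow (c i)) κ
    let K := FunctorCostructuredArrow (Ψ ⋙ Φ) F
    have : IsCardinalFiltered K κ := isCardinalFiltered_functorCostructuredArrow hI hid hwf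
    have (i : I) : (evaluationCostructuredArrow (Ψ ⋙ Φ) F i).Final :=
      final_evaluationCostructuredArrow hI hid hwf i
    have hK : IsColimit (tautologicalCocone
        ((Functor.whiskeringRight I _ B).obj (Ψ ⋙ Φ)) F) :=
      evaluationJointlyReflectsColimits _ fun i ↦
        (Functor.Final.isColimitWhiskerEquiv (evaluationCostructuredArrow (Ψ ⋙ Φ) F i) _).symm
          (nonempty_isColimit_tautologicalCocone (hc i)).some
    have : EssentiallySmall.{w} (I ⥤ InducedCategory C ψ) := essentiallySmallSelf _
    let e := equivSmallModel.{w} K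
    have := IsCardinalFiltered.of_equivalence κ e
    exact ⟨SmallModel.{w} K, inferInstance, inferInstance,
      e.inverse ⋙ CostructuredArrow.proj _ _ ⋙ (Functor.whiskeringRight I _ C).obj Ψ,
      { app j := (e.inverse.obj j).hom
        naturality _ _ f :=
          ((tautologicalCocone _ F).whisker e.inverse).ι.naturality f },
      ⟨(Functor.Final.isColimitWhiskerEquiv e.inverse _).symm hK⟩⟩

omit [HasCardinalFilteredColimits B κ] in
lemma IsIndEmbedding.whiskeringRight_of_equivalence {C : Type u₁} [Category.{v₁} C] {Φ : C ⥤ B}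
    {I : Type u₃} [Category.{v₃} I] {J : Type u₄} [Category.{v₄} J] (e : I ≌ J)
    (h : IsIndEmbedding ((Functor.whiskeringRight J C B).obj Φ) κ) :
    IsIndEmbedding ((Functor.whiskeringRight I C B).obj Φ) κ :=
  ((h.comp_isEquivalence e.congrLeft.inverse).isEquivalence_comp e.congrLeft.functor).of_iso
    (NatIso.ofComponents (fun F ↦ Functor.isoWhiskerRight e.unitIso.symm (F ⋙ Φ)) fun f ↦ by
      ext i
      exact ((Functor.whiskerRight f Φ).naturality (e.unitIso.inv.app i)).symm)

end FunctorCategory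

/-! ### Passage to a skeleton. -/

section WellFounded

variable {I : Type u₁} [Category.{v₁} I]

lemma nonempty_iso_of_endo_eq_id (h : ∀ (x : I) (f : x ⟶ x), f = 𝟙 x) {x y : I}
    (f : x ⟶ y) (g : y ⟶ x) : Nonempty (x ≅ y) :=
  ⟨⟨f, g, h _ _, h _ _⟩⟩

lemma IsWellFoundedCategory.endo_eq_id_of_equivalence (h : IsWellFoundedCategory I)
    {J : Type u₂} [Category.{v₂} J] (e : J ≌ I) (x : J) (f : x ⟶ x) : f = 𝟙 x :=
  e.functor.map_injective ((h.endo_eq_id _ _).trans (h.endo_eq_id _ _).symm)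

/-- Opposite arrows are mutually inverse when endomorphisms are trivial. In a skeleton, an arrow
between distinct objects therefore descends strictly in the posetal reflection. -/
lemma IsWellFoundedCategory.wellFounded_of_skeletal (h : IsWellFoundedCategory I)
    {J : Type u₂} [Category.{v₂} J] (e : J ≌ I) (hJ : Skeletal J) :
    WellFounded fun x y : J ↦ Nonempty (x ⟶ y) ∧ x ≠ y := by
  refine Subrelation.wf ?_ (InvImage.wf (fun x : J ↦ toAntisymmetrization (α := HomOrder I) (· ≤ ·)
    (e.functor.obj x)) h.wellFounded)
  rintro x y ⟨⟨f⟩, hxy⟩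
  refine lt_of_le_not_ge ⟨e.functor.map f⟩ fun ⟨g⟩ ↦ hxy ?_
  exact hJ (nonempty_iso_of_endo_eq_id h.endo_eq_id (e.functor.map f) g |>.map
    e.functor.preimageIso)

variable {κ : Cardinal.{w}} [Fact κ.IsRegular]

lemma hasCardinalLT_arrow (h₀ : HasCardinalLT I κ) (h₁ : ∀ x y : I, HasCardinalLT (x ⟶ y) κ) :
    HasCardinalLT (Arrow I) κ :=
  (hasCardinalLT_sigma (fun x : I ↦ Σ y : I, (x ⟶ y)) κ h₀
    fun x ↦ hasCardinalLT_sigma _ κ h₀ fun y ↦ h₁ x y).of_surjective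
      (fun a ↦ Arrow.mk a.2.2) fun f ↦ ⟨⟨f.left, f.right, f.hom⟩, rfl⟩

lemma hasCardinalLT_arrow_skeleton (h : HasCardinalLT (Arrow I) κ) :
    HasCardinalLT (Arrow (Skeleton I)) κ :=
  hasCardinalLT_arrow ((hasCardinalLT_of_hasCardinalLT_arrow h).of_surjective toSkeleton
      fun x ↦ ⟨(fromSkeleton I).obj x, toSkeleton_fromSkeleton_obj x⟩)
    fun _ _ ↦ (hasCardinalLT_hom_of_arrow h _ _).of_injective
      (fun f ↦ (fromSkeleton I).map f) (fromSkeleton I).map_injective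

end WellFounded

theorem IsIndEmbedding.whiskeringRight {B : Type u₂} [Category.{v₂} B] {κ : Cardinal.{w}}
    [Fact κ.IsRegular] [HasCardinalFilteredColimits B κ] {C : Type u₁} [Category.{w} C]
    {Φ : C ⥤ B} (h : IsIndEmbedding Φ κ) {I : Type u₃} [Category.{v₃} I]
    (h₁ : IsEssentiallyCardinalSmall I κ) (h₂ : IsWellFoundedCategory I) :
    IsIndEmbedding ((Functor.whiskeringRight I C B).obj Φ) κ := by
  obtain ⟨J, _, hJ, ⟨e⟩⟩ := h₁
  let e' : Skeleton J ≌ I := (skeletonEquivalence J).trans e.symm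
  exact whiskeringRight_of_equivalence e'.symm (h.whiskeringRight_of_skeletal
    (hasCardinalLT_arrow_skeleton hJ) (h₂.endo_eq_id_of_equivalence e')
    (h₂.wellFounded_of_skeletal e' (skeleton_skeletal J)))

theorem isEquivalence_comparison {κ : Cardinal.{w}} [Fact κ.IsRegular] {I : Type w}
    [SmallCategory I] (h₁ : IsEssentiallyCardinalSmall I κ) (h₂ : IsWellFoundedCategory I)
    (C : Type u) [Category.{w} C] : (comparison I C κ).IsEquivalence :=
  (isEquivalence_comparison_iff I C κ).2 ((isIndEmbedding_toInd κ).whiskeringRight h₁ h₂)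

/-! ### Splitting idempotents by filtered colimits. -/

section Idempotent

variable {A : Type u} [Category.{v₁} A]

/-- The constant diagram given by an idempotent, indexed by a partially ordered type. -/
noncomputable def idempotentFunctor (T : Type u₁) [PartialOrder T] {X : A} (p : X ⟶ X)
    (hp : p ≫ p = p) : T ⥤ A where
  obj _ := X
  map {a b} _ := open Classical in if a = b then 𝟙 X else p
  map_comp {a b c} f g := by
    have hab := leOfHom f
    have hbc := leOfHom g
    obtain rfl | h₁ := eq_or_ne a b
    · simp
    obtain rfl | h₂ := eq_or_ne b c
    · simp
    have h₃ : a ≠ c := ((lt_of_le_of_ne hab h₁).trans_le hbc).ne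
    simp [h₁, h₂, h₃, hp]

/-- The colimit of the diagram `X ⟶ X ⟶ ⋯` of length `κ`, all of whose strict transitions are `p`,
is the image of `p`. The absence of a maximal index makes `p` act trivially on every coprojection,
so that all coprojections agree. -/
theorem isIdempotentComplete_of_hasCardinalFilteredColimits (κ : Cardinal.{w}) [Fact κ.IsRegular]
    [HasCardinalFilteredColimits A κ] : IsIdempotentComplete A where
  idempotents_split X p hp := by
    have := HasCardinalFilteredColimits.hasColimitsOfShape A κ κ.ord.ToType
    have hκ : Cardinal.aleph0 ≤ κ := Cardinal.IsRegular.aleph0_le Fact.out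
    have := Cardinal.noMaxOrder hκ
    let F := idempotentFunctor κ.ord.ToType p hp
    have hF {a b : κ.ord.ToType} (h : a < b) : F.map (homOfLE h.le) = p := if_neg h.ne
    let l (a : κ.ord.ToType) : X ⟶ colimit F := colimit.ι F a
    have hw (a b : κ.ord.ToType) (h : a < b) : p ≫ l b = l a :=
      (hF h).symm ▸ colimit.w F (homOfLE h.le)
    have hp' (a : κ.ord.ToType) : p ≫ l a = l a := by
      obtain ⟨b, hb⟩ := exists_gt a
      rw [← hw a b hb, reassoc_of% hp]
    have heq (a b : κ.ord.ToType) : l a = l b := by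
      obtain h | rfl | h := lt_trichotomy a b
      · rw [← hw a b h, hp' b]
      · rfl
      · rw [← hw b a h, hp' a]
    obtain ⟨a₀⟩ : Nonempty κ.ord.ToType := IsCardinalFiltered.nonempty _ κ
    let s : colimit F ⟶ X := colimit.desc F
      { pt := X
        ι :=
          { app _ := p
            naturality a b f := by
              obtain h | h := (leOfHom f).eq_or_lt
              · subst h
                exact (congr_arg (· ≫ p) (F.map_id a)).trans
                  ((Category.id_comp p).trans (Category.comp_id p).symm)
              · exact (congr_arg (· ≫ p) (hF h)).trans (hp.trans (Category.comp_id p).symm) } }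
    have hs (a : κ.ord.ToType) : l a ≫ s = p := colimit.ι_desc _ _
    refine ⟨colimit F, s, l a₀, colimit.hom_ext fun a ↦ ?_, hs a₀⟩
    change l a ≫ s ≫ l a₀ = l a ≫ 𝟙 _
    rw [reassoc_of% (hs a), hp', Category.comp_id, heq]

theorem isIdempotentComplete_fullSubcategory (P : ObjectProperty A) [P.IsStableUnderRetracts]
    [IsIdempotentComplete A] : IsIdempotentComplete P.FullSubcategory where
  idempotents_split X p hp := by
    obtain ⟨Y, i, e, h₁, h₂⟩ := IsIdempotentComplete.idempotents_split X.obj p.hom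
      (by rw [← ObjectProperty.FullSubcategory.comp_hom, hp])
    exact ⟨⟨Y, P.prop_of_retract ⟨i, e, h₁⟩ X.property⟩, ObjectProperty.homMk i,
      ObjectProperty.homMk e, ObjectProperty.hom_ext _ h₁, ObjectProperty.hom_ext _ h₂⟩

end Idempotent

/-! ### An ind-embedding identifies its target with the ind-completion. -/

section RestrictedYoneda

variable {C : Type u₁} [Category.{w} C] {B : Type u₂} [Category.{w} B] (Φ : C ⥤ B)
  {κ : Cardinal.{w}} [Fact κ.IsRegular]

/-- The functor `B ⥤ Cᵒᵖ ⥤ Type w` induced by a functor `Φ : C ⥤ B`, sending `Y` to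
the presheaf `X ↦ (Φ.obj X ⟶ Y)`. -/
abbrev restrictedYoneda : B ⥤ Cᵒᵖ ⥤ Type w :=
  yoneda ⋙ (Functor.whiskeringLeft _ _ _).obj Φ.op

/-- The restriction to `C` of the restricted Yoneda functor. -/
noncomputable def compRestrictedYoneda [Φ.Full] [Φ.Faithful] : Φ ⋙ restrictedYoneda Φ ≅ yoneda :=
  NatIso.ofComponents
    (fun X ↦ NatIso.ofComponents
      (fun Y ↦ ((Functor.FullyFaithful.ofFullyFaithful Φ).homEquiv (X := Y.unop)).symm.toIso)
      (fun f ↦ by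
        ext g
        exact Φ.map_injective (by simp)))
    (fun f ↦ by
      ext Y g
      exact Φ.map_injective (by simp))

variable {Φ}

lemma IsIndEmbedding.preservesColimitsOfShape_restrictedYoneda (h : IsIndEmbedding Φ κ)
    (J : Type w) [SmallCategory J] [IsCardinalFiltered J κ] :
    PreservesColimitsOfShape J (restrictedYoneda Φ) :=
  preservesColimitsOfShape_of_evaluation _ _ fun X ↦
    have := h.isCardinalPresentable X.unop
    preservesColimitsOfShape_of_isCardinalPresentable (Φ.obj X.unop) κ J

lemma IsIndEmbedding.isIndObject_restrictedYoneda (h : IsIndEmbedding Φ κ) (Y : B) :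
    isIndObject C κ ((restrictedYoneda Φ).obj Y) := by
  have := h.full
  have := h.faithful
  obtain ⟨J, _, _, F, α, ⟨hα⟩⟩ := h.exists_isColimit Y
  have := isFiltered_of_isCardinalFiltered J κ
  have := h.preservesColimitsOfShape_restrictedYoneda J
  let e : F ⋙ yoneda ≅ (F ⋙ Φ) ⋙ restrictedYoneda Φ :=
    (Functor.isoWhiskerLeft F (compRestrictedYoneda Φ)).symm
  exact ⟨.ofCocone _ ((IsColimit.precomposeHomEquiv e _).symm
    (isColimitOfPreserves (restrictedYoneda Φ) hα)), ‹_›⟩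

/-- The functor to the category of ind-objects induced by the restricted Yoneda functor. -/
abbrev IsIndEmbedding.toIndCat (h : IsIndEmbedding Φ κ) : B ⥤ IndCat C κ :=
  (isIndObject C κ).lift (restrictedYoneda Φ) h.isIndObject_restrictedYoneda

/-- The restriction to `C` of the functor `toIndCat`. -/
noncomputable def IsIndEmbedding.compToIndCat (h : IsIndEmbedding Φ κ) :
    Φ ⋙ h.toIndCat ≅ toInd C κ :=
  have := h.full
  have := h.faithful
  ((isIndObject C κ).fullyFaithfulι.whiskeringRight C).preimageIso (compRestrictedYoneda Φ)

theorem IsIndEmbedding.isEquivalence_toIndCat (h : IsIndEmbedding Φ κ)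
    [HasCardinalFilteredColimits B κ] : h.toIndCat.IsEquivalence :=
  h.isEquivalence _ ((isIndEmbedding_toInd κ).of_iso h.compToIndCat.symm)
    (fun J _ _ _ ↦
      have := HasCardinalFilteredColimits.hasColimitsOfShape B κ J
      inferInstance)
    (fun J _ _ _ ↦
      have := h.preservesColimitsOfShape_restrictedYoneda J
      have : PreservesColimitsOfShape J (h.toIndCat ⋙ (isIndObject C κ).ι) := this
      have := preservesColimitsOfShape_of_reflects_of_preserves (J := J)
        h.toIndCat (isIndObject C κ).ι
      inferInstance)

end RestrictedYoneda

/-! ### Transfer to accessible categories. -/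

section Accessible

variable {A : Type u} [Category.{w} A] {κ : Cardinal.{w}} [Fact κ.IsRegular]

variable (A κ) in
lemma isIndEmbedding_isCardinalPresentable [IsCardinalAccessibleCategory A κ] :
    IsIndEmbedding (isCardinalPresentable A κ).ι κ where
  full := inferInstance
  faithful := inferInstance
  isCardinalPresentable X := inferInstance
  exists_isColimit Y := by
    obtain ⟨J, _, _, ⟨p⟩⟩ :=
      (isCardinalFilteredGenerator_isCardinalPresentable A κ).exists_colimitsOfShape Y
    exact ⟨J, inferInstance, inferInstance, (isCardinalPresentable A κ).lift p.diag p.prop_diag_obj,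
      p.ι, ⟨p.isColimit⟩⟩

theorem isIndEmbedding_whiskeringRight_of_isEquivalence_comparison
    [IsCardinalAccessibleCategory A κ] (I : Type w) [SmallCategory I]
    [(comparison I (isCardinalPresentable A κ).FullSubcategory κ).IsEquivalence] :
    IsIndEmbedding ((Functor.whiskeringRight I _ A).obj (isCardinalPresentable A κ).ι) κ := by
  have h := isIndEmbedding_isCardinalPresentable A κ
  have := h.isEquivalence_toIndCat
  let e : IndCat _ κ ≌ A := h.toIndCat.asEquivalence.symm
  exact (((isEquivalence_comparison_iff I _ κ).1 inferInstance).comp_isEquivalence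
    (e.congrRight (E := I)).functor).of_iso
      ((Functor.whiskeringRight I _ A).mapIso
        (Functor.isoWhiskerRight h.compToIndCat.symm e.functor ≪≫
          Functor.isoWhiskerLeft (isCardinalPresentable A κ).ι
            h.toIndCat.asEquivalence.unitIso.symm))

/-- A presentable functor is a retract of one with values in `A_κ`, and evaluation preserves
retracts; conversely a pointwise presentable functor lies in the image of the embedding. -/
theorem isCardinalAccessibleCategory_functor_of_isIndEmbedding
    [IsCardinalAccessibleCategory A κ] {I : Type w} [SmallCategory I]
    (h : IsIndEmbedding ((Functor.whiskeringRight I _ A).obj (isCardinalPresentable A κ).ι) κ) :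
    IsCardinalAccessibleCategory (I ⥤ A) κ ∧
      ∀ F : I ⥤ A, IsCardinalPresentable F κ ↔ ∀ i : I, IsCardinalPresentable (F.obj i) κ := by
  have : HasCardinalFilteredColimits (I ⥤ A) κ := ⟨fun J _ _ ↦
    have := HasCardinalFilteredColimits.hasColimitsOfShape A κ J
    inferInstance⟩
  let C := (isCardinalPresentable A κ).FullSubcategory
  have : EssentiallySmall.{w} (I ⥤ C) := by
    rw [essentiallySmall_congr ((equivSmallModel.{w} C).congrRight (E := I))]
    exact essentiallySmallSelf _
  refine ⟨h.isCardinalAccessibleCategory, fun F ↦ ⟨fun hF i ↦ ?_, fun hF ↦ ?_⟩⟩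
  · obtain ⟨X, ⟨r⟩⟩ := h.retract_of_isCardinalPresentable F
    have : IsCardinalPresentable (X.obj i).obj κ := (X.obj i).property
    exact (r.map ((evaluation I A).obj i)).isCardinalPresentable κ
      (X := (X.obj i).obj) (Y := F.obj i)
  · exact h.isCardinalPresentable ((isCardinalPresentable A κ).lift F hF)

end Accessible

/-! ### The graded test category: trivial endomorphisms and well-foundedness. -/

section GradedCategory

/-- Objects of `I` equipped with a degree in `T`. -/
structure Graded (I : Type u₁) (T : Type u₂) where
  /-- the underlying object -/
  obj : I
  /-- the degree -/
  deg : T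

namespace Graded

variable {I : Type u₁} [Category.{v₁} I] {T : Type u₂} [PartialOrder T]

/-- Morphisms between graded objects are morphisms between the underlying objects, which are
required to be identities unless they strictly increase degrees. -/
@[ext]
structure Hom (x y : Graded I T) where
  /-- the underlying morphism -/
  hom : x.obj ⟶ y.obj
  lt_or_eq : x.deg < y.deg ∨ (x.deg = y.deg ∧ ∃ h : x.obj = y.obj, hom = eqToHom h)

instance : Category (Graded I T) where
  Hom := Hom
  id x := ⟨𝟙 _, .inr ⟨rfl, rfl, rfl⟩⟩
  comp {x y z} f g := ⟨f.hom ≫ g.hom, by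
    obtain hf | ⟨hf, hf', hf''⟩ := f.lt_or_eq
    · obtain hg | ⟨hg, -⟩ := g.lt_or_eq
      · exact .inl (hf.trans hg)
      · exact .inl (hg ▸ hf)
    · obtain hg | ⟨hg, hg', hg''⟩ := g.lt_or_eq
      · exact .inl (hf ▸ hg)
      · exact .inr ⟨hf.trans hg, hf'.trans hg', by rw [hf'', hg'', eqToHom_trans]⟩⟩
  id_comp f := Hom.ext (Category.id_comp f.hom)
  comp_id f := Hom.ext (Category.comp_id f.hom)
  assoc f g h := Hom.ext (Category.assoc f.hom g.hom h.hom)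

variable (I T) in
/-- The functor which forgets the degree. -/
def forget : Graded I T ⥤ I where
  obj x := x.obj
  map f := f.hom

lemma endo_eq_id {x : Graded I T} (f : x ⟶ x) : f = 𝟙 x := by
  obtain h | ⟨_, _, h⟩ := Hom.lt_or_eq f
  · exact (lt_irrefl _ h).elim
  · exact Hom.ext h

variable (T) in
/-- The diagram indexed by `T` consisting of the graded objects over a given object. -/
def diagram (y : I) : T ⥤ Graded I T where
  obj a := ⟨y, a⟩
  map f := ⟨𝟙 y, by
    obtain h | h := (leOfHom f).lt_or_eq
    · exact .inl h
    · exact .inr ⟨h, rfl, rfl⟩⟩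
  map_id _ := rfl
  map_comp _ _ := Hom.ext (Category.comp_id _).symm

end Graded

variable (I : Type w) [SmallCategory I] (κ : Cardinal.{w}) [Fact κ.IsRegular]

/-- Any arrow `x ⟶ y` underlies an arrow from `x` in degree `b` to `y` in degree `a` once `b < a`.
The representables of the copies of `y` thus have as colimit the presheaf of all arrows to `y`. -/
lemma isIndObject_forget_comp_yoneda (y : I) :
    isIndObject (Graded I κ.ord.ToType) κ
      ((Graded.forget I κ.ord.ToType).op ⋙ yoneda.obj y) := by
  have := Cardinal.noMaxOrder (Cardinal.IsRegular.aleph0_le (Fact.out : κ.IsRegular))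
  have := isFiltered_of_isCardinalFiltered κ.ord.ToType κ
  let c : Cocone (Graded.diagram κ.ord.ToType y ⋙ yoneda) :=
    { pt := (Graded.forget I κ.ord.ToType).op ⋙ yoneda.obj y
      ι :=
        { app a := yonedaMap (Graded.forget I κ.ord.ToType) ⟨y, a⟩
          naturality a b f := by
            ext x g
            exact Category.comp_id _ } }
  refine ⟨.ofCocone c (evaluationJointlyReflectsColimits _ fun x ↦ ?_),
    (inferInstance : IsCardinalFiltered κ.ord.ToType κ)⟩
  refine Types.FilteredColimit.isColimitOf' _ _ (fun f ↦ ?_) (fun a f g h ↦ ?_)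
  · obtain ⟨b, hb⟩ := exists_gt x.unop.deg
    exact ⟨b, ⟨f, .inl hb⟩, rfl⟩
  · exact ⟨a, 𝟙 a, congr_arg _ (Graded.Hom.ext h)⟩

/-- The functor which sends `y` to the colimit of the graded objects over `y`. -/
noncomputable abbrev gradedColimit : I ⥤ IndCat (Graded I κ.ord.ToType) κ :=
  (isIndObject _ κ).lift (yoneda ⋙ (Functor.whiskeringLeft _ _ _).obj
    (Graded.forget I κ.ord.ToType).op) (isIndObject_forget_comp_yoneda I κ)

variable {I}

/-- The canonical map from a graded object over `y`. -/
noncomputable def toGradedColimit (y : I) (a : κ.ord.ToType) :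
    (toInd (Graded I κ.ord.ToType) κ).obj ⟨y, a⟩ ⟶ (gradedColimit I κ).obj y :=
  ObjectProperty.homMk (yonedaMap (Graded.forget I κ.ord.ToType) ⟨y, a⟩)

variable {κ}

lemma nonempty_hom_of_toInd_hom {x : Graded I κ.ord.ToType} {y : I}
    (f : (toInd (Graded I κ.ord.ToType) κ).obj x ⟶ (gradedColimit I κ).obj y) :
    Nonempty (x.obj ⟶ y) :=
  ⟨yonedaEquiv f.hom⟩

lemma eq_id_of_toGradedColimit_comp {y : I} {a : κ.ord.ToType} {f : y ⟶ y}
    (h : toGradedColimit κ y a ≫ (gradedColimit I κ).map f = toGradedColimit κ y a) :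
    f = 𝟙 y := by
  have h' := congr_arg (fun g ↦ yonedaEquiv g.hom) h
  exact (Category.id_comp f).symm.trans h'

lemma retract_endo_eq_id {P : IndCat (Graded I κ.ord.ToType) κ} {x : Graded I κ.ord.ToType}
    (r : Retract P ((toInd _ κ).obj x)) (f : P ⟶ P) : f = 𝟙 P := by
  obtain ⟨g, hg⟩ := (toInd _ κ).map_surjective (r.r ≫ f ≫ r.i)
  rw [Graded.endo_eq_id g, CategoryTheory.Functor.map_id] at hg
  have := r.i ≫= (hg =≫ r.r)
  simpa using this.symm

/-- In a presentation of `F` as a `κ`-filtered colimit of presentable functors, fewer than `κ` maps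
from presentable objects into values of `F` factor through a common stage. -/
lemma exists_presentable_hom {B : Type u₁} [Category.{v₁} B] [HasCardinalFilteredColimits B κ]
    [IsCardinalAccessibleCategory (I ⥤ B) κ] (F : I ⥤ B)
    {K : Type u₂} (hK : HasCardinalLT K κ) (y : K → I) (X : K → B)
    [∀ k, IsCardinalPresentable (X k) κ] (t : ∀ k, X k ⟶ F.obj (y k)) :
    ∃ (G : I ⥤ B) (_ : IsCardinalPresentable G κ) (c : G ⟶ F) (s : ∀ k, X k ⟶ G.obj (y k)),
      ∀ k, s k ≫ c.app (y k) = t k := by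
  obtain ⟨J, _, _, ⟨p⟩⟩ :=
    (isCardinalFilteredGenerator_isCardinalPresentable (I ⥤ B) κ).exists_colimitsOfShape F
  have := essentiallySmallSelf J
  have := HasCardinalFilteredColimits.hasColimitsOfShape B κ J
  choose j s hs using fun k ↦ IsCardinalPresentable.exists_hom_of_isColimit κ
    (isColimitOfPreserves ((evaluation I B).obj (y k)) p.isColimit) (t k)
  refine ⟨p.diag.obj (IsCardinalFiltered.max j hK), p.prop_diag_obj _, p.ι.app _,
    fun k ↦ s k ≫ (p.diag.map (IsCardinalFiltered.toMax j hK k)).app (y k), fun k ↦ ?_⟩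
  rw [← hs, Category.assoc, ← NatTrans.comp_app, p.w]
  rfl

section

variable [IsCardinalAccessibleCategory (I ⥤ IndCat (Graded I κ.ord.ToType) κ) κ]
  (h : ∀ (G : I ⥤ IndCat (Graded I κ.ord.ToType) κ), IsCardinalPresentable G κ →
    ∀ i, IsCardinalPresentable (G.obj i) κ)

include h

/-- A presentable `G` over `gradedColimit` through which the canonical map at `i` factors has at `i`
a retract of a representable, so `G.map f` is the identity. Hence `f` fixes the canonical map, which
corresponds to the identity of `i`. -/
lemma endo_eq_id_of_accessible (i : I) (f : i ⟶ i) : f = 𝟙 i := by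
  have hX := (isIndEmbedding_toInd (C := Graded I κ.ord.ToType) κ)
  have a : κ.ord.ToType := Classical.choice (IsCardinalFiltered.nonempty _ κ)
  have := hX.isCardinalPresentable ⟨i, a⟩
  obtain ⟨G, hG, c, s, hs⟩ := exists_presentable_hom (gradedColimit I κ)
    (K := PUnit.{w + 1}) (hasCardinalLT_of_finite _ _ (Cardinal.IsRegular.aleph0_le (Fact.out : κ.IsRegular)))
    (fun _ ↦ i) (fun _ ↦ (toInd (Graded I κ.ord.ToType) κ).obj ⟨i, a⟩)
    (fun _ ↦ toGradedColimit κ i a)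
  have := h G hG i
  obtain ⟨x, ⟨r⟩⟩ := hX.retract_of_isCardinalPresentable (G.obj i)
  apply eq_id_of_toGradedColimit_comp (κ := κ) (a := a)
  rw [← hs ⟨⟩, Category.assoc, ← c.naturality, retract_endo_eq_id r (G.map f), Category.id_comp]

/-- Along a descending chain, one presentable `G` has as values retracts of graded objects `x n`.
Their degrees would form a descending chain of ordinals. The bound on the posetal reflection ensures
that the chain has fewer than `κ` terms, so a single `G` can serve for all of them. -/
lemma wellFounded_of_accessible (hI : HasCardinalLT (PosetalReflection I) κ) :
    WellFounded fun x y : PosetalReflection I ↦ x < y := by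
  rw [wellFounded_iff_isEmpty_descending_chain]
  refine ⟨fun ⟨z, hz⟩ ↦ ?_⟩
  have hz' : StrictAnti z := strictAnti_nat_of_succ_lt hz
  have hX := (isIndEmbedding_toInd (C := Graded I κ.ord.ToType) κ)
  have a : κ.ord.ToType := Classical.choice (IsCardinalFiltered.nonempty _ κ)
  let y (n : ℕ) : I := ofAntisymmetrization (α := HomOrder I) (· ≤ ·) (z n)
  have hy (n : ℕ) : Nonempty (y (n + 1) ⟶ y n) ∧ ¬ Nonempty (y n ⟶ y (n + 1)) :=
    lt_iff_le_not_ge.1 ((ofAntisymmetrization_lt_ofAntisymmetrization_iff (α := HomOrder I)).2 (hz n))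
  have (n : ℕ) := hX.isCardinalPresentable ⟨y n, a⟩
  obtain ⟨G, hG, c, s, hs⟩ := exists_presentable_hom (gradedColimit I κ)
    (hI.of_injective z hz'.injective) y
    (fun n ↦ (toInd (Graded I κ.ord.ToType) κ).obj ⟨y n, a⟩)
    (fun n ↦ toGradedColimit κ (y n) a)
  have hr (n : ℕ) : ∃ x : Graded I κ.ord.ToType,
      Nonempty (Retract (G.obj (y n)) ((toInd _ κ).obj x)) := by
    have := h G hG (y n)
    exact hX.retract_of_isCardinalPresentable (G.obj (y n))
  choose x r using hr
  have hdeg (n : ℕ) : (x (n + 1)).deg < (x n).deg := by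
    obtain ⟨⟨f⟩, hf⟩ := hy n
    obtain ⟨r₁⟩ := r n
    obtain ⟨r₂⟩ := r (n + 1)
    obtain h | ⟨_, h, _⟩ :=
      Graded.Hom.lt_or_eq ((toInd _ κ).preimage (r₂.r ≫ G.map f ≫ r₁.i))
    · exact h
    · obtain ⟨g⟩ := nonempty_hom_of_toInd_hom (r₂.r ≫ c.app (y (n + 1)))
      exact (hf ⟨((toInd _ κ).preimage (s n ≫ r₁.i)).hom ≫ eqToHom h.symm ≫ g⟩).elim
  exact (wellFounded_iff_isEmpty_descending_chain.1
    (wellFounded_lt (α := κ.ord.ToType))).false ⟨fun n ↦ (x n).deg, hdeg⟩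

end

end GradedCategory

/-! ### Set-valued functors: the size of `I`. -/

section Small

variable {I : Type w} [SmallCategory I] {κ : Cardinal.{w}} [Fact κ.IsRegular]

lemma isCardinalPresentable_coyoneda (x : I) :
    IsCardinalPresentable (coyoneda.obj (op x)) κ :=
  Functor.isCardinalAccessible_of_natIso
    (show (evaluation I (Type w)).obj x ≅ coyoneda.obj (op (coyoneda.obj (op x))) from
      NatIso.ofComponents (fun P ↦ (coyonedaEquiv (X := x) (F := P)).symm.toIso) (by
        intro P Q f
        ext a
        let e (R : I ⥤ Type w) := coyonedaEquiv (X := x) (F := R)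
        refine (e Q).injective (((e Q).apply_symm_apply _).trans ?_)
        exact (congr_arg (f.app x) ((e P).apply_symm_apply a).symm).trans
          (coyonedaEquiv_comp ((e P).symm a) f).symm)) κ

/-- This is what makes `propFunctor` compatible with composition. -/
lemma isIso_comp_iff_of_endo_eq_id (hid : ∀ (x : I) (f : x ⟶ x), f = 𝟙 x) {x y z : I}
    (f : x ⟶ y) (g : y ⟶ z) : IsIso (f ≫ g) ↔ IsIso f ∧ IsIso g := by
  refine ⟨fun _ ↦ ?_, fun ⟨_, _⟩ ↦ inferInstance⟩
  exact ⟨⟨g ≫ inv (f ≫ g), hid _ _, hid _ _⟩, ⟨inv (f ≫ g) ≫ f, hid _ _, hid _ _⟩⟩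

/-- The class of an object in the posetal reflection. -/
abbrev posetalClass (x : I) : PosetalReflection I :=
  toAntisymmetrization (α := HomOrder I) (· ≤ ·) x

lemma posetalClass_eq {x y : I} (f : x ⟶ y) [IsIso f] : posetalClass x = posetalClass y :=
  Quotient.sound ⟨⟨f⟩, ⟨inv f⟩⟩

/-- The functor whose values are the type of propositions, such that the proposition `True`
is sent to `False` by the morphisms which are not isomorphisms, restricted to a class of objects. -/
def propFunctor (hid : ∀ (x : I) (f : x ⟶ x), f = 𝟙 x) (S : Set (PosetalReflection I)) :
    I ⥤ Type w where
  obj x := { p : ULift.{w} Prop // p.down → posetalClass x ∈ S }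
  map f := ↾fun p ↦ ⟨⟨p.1.down ∧ IsIso f⟩, fun ⟨h₁, h₂⟩ ↦ posetalClass_eq f ▸ p.2 h₁⟩
  map_id x := by
    ext p
    exact and_iff_left (inferInstance : IsIso (𝟙 x))
  map_comp f g := by
    ext p
    exact (and_congr_right' (isIso_comp_iff_of_endo_eq_id hid f g)).trans and_assoc.symm

/-- The functoriality of `propFunctor` with respect to inclusions. -/
def propFunctorMap (hid : ∀ (x : I) (f : x ⟶ x), f = 𝟙 x) {S S' : Set (PosetalReflection I)}
    (h : S ⊆ S') : propFunctor hid S ⟶ propFunctor hid S' where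
  app x := ↾fun p ↦ ⟨p.1, fun hp ↦ h (p.2 hp)⟩

/-- The functor `propFunctor hid Set.univ` has finite values, so it is presentable by hypothesis. It
is also the `κ`-filtered union of the subfunctors supported on fewer than `κ` classes; its identity
factors through one of these, which must then contain every class. -/
lemma hasCardinalLT_posetalReflection (hid : ∀ (x : I) (f : x ⟶ x), f = 𝟙 x)
    (h : ∀ F : I ⥤ Type w, (∀ i, IsCardinalPresentable (F.obj i) κ) → IsCardinalPresentable F κ) :
    HasCardinalLT (PosetalReflection I) κ := by
  have hκ : Cardinal.aleph0 ≤ κ := Cardinal.IsRegular.aleph0_le Fact.out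
  let J := HasCardinalLT.Set (PosetalReflection I) κ
  have := essentiallySmallSelf J
  let D : J ⥤ I ⥤ Type w :=
    { obj S := propFunctor hid S.1
      map f := propFunctorMap hid (leOfHom f) }
  let c : Cocone D :=
    { pt := propFunctor hid Set.univ
      ι := { app S := propFunctorMap hid (Set.subset_univ _) } }
  have hc : IsColimit c := evaluationJointlyReflectsColimits _ fun x ↦ by
    refine Types.FilteredColimit.isColimitOf' _ _ (fun p ↦ ?_) (fun S (p q : (propFunctor hid S.1).obj x) h ↦ ?_)
    · exact ⟨⟨{posetalClass x}, hasCardinalLT_of_finite _ _ hκ⟩, ⟨p.1, fun _ ↦ rfl⟩, rfl⟩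
    · have hpq : p.1 = q.1 := congr_arg (fun r : (propFunctor hid Set.univ).obj x ↦ r.1) h
      exact ⟨S, 𝟙 S, congr_arg _ (Subtype.ext hpq)⟩
  have (i : I) : Finite ((propFunctor hid Set.univ).obj i) :=
    inferInstanceAs (Finite { p : ULift.{w} Prop // _ })
  have : IsCardinalPresentable (propFunctor hid Set.univ) κ := h _ fun i ↦
    (Types.isCardinalPresentable_iff κ).2 (hasCardinalLT_of_finite _ _ hκ)
  obtain ⟨S, f, hf⟩ := IsCardinalPresentable.exists_hom_of_isColimit κ hc
    (𝟙 (propFunctor hid Set.univ))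
  have hS (z : PosetalReflection I) : z ∈ S.1 := by
    obtain ⟨x, rfl⟩ := Quotient.exists_rep z
    -- The element `True` over `x` can lie in the subfunctor only if the class of `x` belongs to
    -- `S`.
    let p : (propFunctor hid Set.univ).obj x := ⟨⟨True⟩, fun _ ↦ trivial⟩
    let q : (propFunctor hid S.1).obj x := f.app x p
    have hq : q.1 = p.1 :=
      congr_arg Subtype.val (ConcreteCategory.congr_hom (NatTrans.congr_app hf x) p)
    exact q.2 (by rw [hq]; trivial)
  exact S.2.of_injective (fun z ↦ ⟨z, hS z⟩) fun _ _ h ↦ congr_arg Subtype.val h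

lemma isEssentiallyCardinalSmall (hid : ∀ (x : I) (f : x ⟶ x), f = 𝟙 x)
    (h₀ : HasCardinalLT (PosetalReflection I) κ) (h₁ : ∀ x y : I, HasCardinalLT (x ⟶ y) κ) :
    IsEssentiallyCardinalSmall I κ := by
  let ρ : PosetalReflection I → I := ofAntisymmetrization (α := HomOrder I) (· ≤ ·)
  have : (inducedFunctor ρ).EssSurj := ⟨fun x ↦ by
    obtain ⟨⟨f⟩, ⟨g⟩⟩ := AntisymmRel.symm
      (Quotient.exact (toAntisymmetrization_ofAntisymmetrization (α := HomOrder I) (· ≤ ·)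
        (posetalClass x)))
    exact ⟨posetalClass x, nonempty_iso_of_endo_eq_id hid g f⟩⟩
  have : (inducedFunctor ρ).IsEquivalence := { }
  exact ⟨InducedCategory I ρ, inferInstance, hasCardinalLT_arrow h₀ fun x y ↦
    (h₁ (ρ x) (ρ y)).of_injective InducedCategory.Hom.hom fun _ _ ↦ InducedCategory.hom_ext,
    ⟨(inducedFunctor ρ).asEquivalence.symm⟩⟩

end Small

end IndFunctorCat

theorem mainTheorem1 (κ : Cardinal.{w}) [Fact κ.IsRegular] (I : Type w) [SmallCategory I] :
    List.TFAE [
      ∀ (C : Type (w + 1)) [Category.{w} C], (IndFunctorCat.comparison I C κ).IsEquivalence,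
      ∀ (C : Type (w + 1)) [Category.{w} C] [IsIdempotentComplete C],
        (IndFunctorCat.comparison I C κ).IsEquivalence,
      ∀ (A : Type (w + 1)) [Category.{w} A] [IsCardinalAccessibleCategory A κ],
        IsCardinalAccessibleCategory (I ⥤ A) κ ∧
          ∀ F : I ⥤ A, IsCardinalPresentable F κ ↔ ∀ i : I, IsCardinalPresentable (F.obj i) κ,
      IndFunctorCat.IsEssentiallyCardinalSmall I κ ∧ IndFunctorCat.IsWellFoundedCategory I] := by
  open IndFunctorCat in
  tfae_have 1 → 2 := fun h C _ _ ↦ h C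
  tfae_have 2 → 3 := fun h A _ _ ↦ by
    have := isIdempotentComplete_of_hasCardinalFilteredColimits (A := A) κ
    have := isIdempotentComplete_fullSubcategory (isCardinalPresentable A κ)
    have := h (isCardinalPresentable A κ).FullSubcategory
    exact isCardinalAccessibleCategory_functor_of_isIndEmbedding
      (isIndEmbedding_whiskeringRight_of_isEquivalence_comparison I)
  tfae_have 3 → 4 := fun h ↦ by
    have : IsCardinalAccessibleCategory (IndCat (Graded I κ.ord.ToType) κ) κ :=
      have := essentiallySmallSelf.{w} (Graded I κ.ord.ToType)
      (isIndEmbedding_toInd κ).isCardinalAccessibleCategory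
    obtain ⟨_, h₁⟩ := h (IndCat (Graded I κ.ord.ToType) κ)
    obtain ⟨_, h₂⟩ := h (Type w)
    have hid := endo_eq_id_of_accessible fun G hG ↦ (h₁ G).1 hG
    have hI := hasCardinalLT_posetalReflection hid fun F hF ↦ (h₂ F).2 hF
    refine ⟨isEssentiallyCardinalSmall hid hI fun x y ↦ ?_, hid,
      wellFounded_of_accessible (fun G hG ↦ (h₁ G).1 hG) hI⟩
    -- Corepresentable functors are presentable, hence pointwise so by (A3); their values are the
    -- hom-sets of `I`.
    exact (Types.isCardinalPresentable_iff κ).1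
      ((h₂ (coyoneda.obj (Opposite.op x))).1 (isCardinalPresentable_coyoneda x) y)
  tfae_have 4 → 1 := fun ⟨h₁, h₂⟩ C _ ↦ isEquivalence_comparison h₁ h₂ C
  tfae_finish
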